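/- Let $d\ge 1$ and let $a:\mathbb R^d\to\mathbb R$ satisfy $a\ge 0$, $a(-x)=a(x)$, $a\in L^1(\mathbb R^d)\cap L^\infty(\mathbb R^d)$, $\int a(x)\,dx=1$, $\int |x|^2a(x)\,dx<\infty$, and, for some $p\ge 1$, $b>0$ and $C_1$, the light-tail bound $a(x)\le C_1e^{-b|x|^p}$ for all $x$. Let $\sigma_{ij}=\int x_ix_ja(x)\,dx$, and for $t\in\mathbb R$ let $$v(x,t)=e^{-t}\sum_{k=1}^\infty \frac{t^k a^{*k}(x)}{k!},$$ where $a^{*k}$ is the $k$-fold convolution power of $a$. Let $X$ be a random vector with density $a$, and let $L(\gamma)=\ln\mathbb E e^{\gamma\cdot X}\in(-\infty,\infty]$ and $I(r)=\sup_{\gamma\in\mathbb R^d}(\gamma\cdot r-L(\gamma))\in[0,\infty]$. If $p=1$, assume in addition condition $\mathbf{A}_1$: $\mathbb E e^{b_1X\cdot\theta}=\infty$ for all $b_1>b$ and all unit vectors $\theta$. Then the series defining $v$ converges at every point, and for every $r\in\mathbb R^d\setminus\{0\}$ the equation $$\ln\xi=I(\xi r)-\xi r\cdot\nabla I(\xi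 r)$$ has a unique solution $\xi=\xi_r>0$, among those $\xi$ for which $I$ is finite near $\xi r$ and differentiable at $\xi r$. Let $$\Phi(r)=1-\frac1{\xi_r}\bigl(1+\ln\xi_r-I(\xi_rr)\bigr),$$ where for $r=0$ the equation gives $\xi_0=1$. The following hold. 1. For every $r\neq 0$ and every $x=x(t)\in\mathbb R^d$ with $x(t)-rt=o(t)$ as $t\to\infty$, $$v(x(t),t)\le e^{-\Phi(r)\,t\,(1+o(1))}\qquad\text{as }t\to\infty.$$ 2. $\Phi(0)=0$, $\Phi(r)>0$ for $r\ne0$, $\Phi$ is convex on $\mathbb R^d$, $\Phi(r)=\tfrac12\,(\sigma^{-1}r\cdot r)\,(1+o(1))$ as $r\to0$, and $\Phi(r)\to\infty$ as $|r|\to\infty$. 3. If $p=1$, then $\Phi(r)=b|r|(1+o(1))$ as $|r|\to\infty$. 4. If $p>1$ and condition $\mathbf{A}_p$ holds, that is, $L(\gamma)=\frac{p-1}{p}(bp)^{-1/(p-1)}|\gamma|^{p/(p-1)}(1+o(1))$ as $|\gamma|\to\infty$ (with $L$ finite), then $$\Phi(r)=\frac p{p-1}\,\bigl(b(p-1)\bigr)^{1/p}\,|r|\,(\ln|r|)^{\frac{p-1}p}\,(1+o(1))\qquad\text{as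 }|r|\to\infty.$$ 5. If $\mu>0$ and $a=0$ almost everywhere outside the ball $\{|x|\le\mu\}$, in particular if $\mu$ is the smallest such radius, then $\Phi(r)\ge\frac1\mu|r|\ln|r|$ for all sufficiently large $|r|$. -/

import Mathlib

open scoped ENNReal

namespace NonlocalHeat

/-- Euclidean space of dimension `d`. -/
abbrev E (d : ℕ) : Type := EuclideanSpace ℝ (Fin d)

/-- Standing assumptions on the convolution kernel: nonnegative, even, bounded and integrable,
of unit mass and with finite second moment. -/
structure IsKernel {d : ℕ} (a : E d → ℝ) : Prop where
  nonneg : ∀ x, 0 ≤ a x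
  even : ∀ x, a (-x) = a x
  integrable : MeasureTheory.Integrable a
  memLp_top : MeasureTheory.MemLp a ∞
  integral_eq_one : ∫ x, a x = 1
  second_moment : MeasureTheory.Integrable (fun x => ‖x‖ ^ 2 * a x)

/-- The light-tail condition `a(x) ≤ C₁ exp(-b |x|^p)`. -/
def LightTail {d : ℕ} (a : E d → ℝ) (C₁ b p : ℝ) : Prop :=
  ∀ x, a x ≤ C₁ * Real.exp (-b * ‖x‖ ^ p)

/-- The covariance matrix `σ i j = ∫ xᵢ xⱼ a(x) dx`. -/
noncomputable def covMatrix {d : ℕ} (a : E d → ℝ) : Matrix (Fin d) (Fin d) ℝ :=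
  Matrix.of fun i j => ∫ x : E d, x i * x j * a x

/-- `convPow a n` is the `(n + 1)`-fold convolution power `a * ⋯ * a` of `a`. -/
noncomputable def convPow {d : ℕ} (a : E d → ℝ) : ℕ → E d → ℝ
  | 0 => a
  | n + 1 => MeasureTheory.convolution (convPow a n) a (ContinuousLinearMap.mul ℝ ℝ)
      MeasureTheory.volume

/-- The term of index `k = n + 1` of the series `∑_{k ≥ 1} t^k a^{*k}(x) / k!`. -/
noncomputable def heatTerm {d : ℕ} (a : E d → ℝ) (x : E d) (t : ℝ) (n : ℕ) : ℝ :=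
  t ^ (n + 1) * convPow a n x / ((n + 1).factorial : ℝ)

/-- The regularized heat kernel `v(x,t) = e^{-t} ∑_{k ≥ 1} t^k a^{*k}(x) / k!`. -/
noncomputable def heatKernel {d : ℕ} (a : E d → ℝ) (x : E d) (t : ℝ) : ℝ :=
  Real.exp (-t) * ∑' n : ℕ, heatTerm a x t n

/-- The distribution on `ℝ^d` with density `a`. -/
noncomputable def law {d : ℕ} (a : E d → ℝ) : MeasureTheory.Measure (E d) :=
  MeasureTheory.volume.withDensity fun x => ENNReal.ofReal (a x)

/-- `Λ(γ) = 𝔼 exp(γ · X) ∈ [0, ∞]`, where `X` has density `a`. -/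
noncomputable def expMoment {d : ℕ} (a : E d → ℝ) (γ : E d) : ℝ≥0∞ :=
  ∫⁻ x, ENNReal.ofReal (Real.exp (inner ℝ γ x)) ∂(law a)

/-- The cumulant generating function `L = ln Λ`, with values in the extended reals. -/
noncomputable def cumulant {d : ℕ} (a : E d → ℝ) (γ : E d) : EReal :=
  ENNReal.log (expMoment a γ)

/-- The rate function `I(r) = sup_γ (γ · r - L(γ))`, with values in the extended reals. -/
noncomputable def rate {d : ℕ} (a : E d → ℝ) (r : E d) : EReal :=
  ⨆ γ : E d, (((inner ℝ γ r : ℝ) : EReal) - cumulant a γ)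

/-- The real-valued version of `I`; meaningful only where `I` is finite. -/
noncomputable def rateReal {d : ℕ} (a : E d → ℝ) (r : E d) : ℝ := (rate a r).toReal

/-- `ξ` is a positive solution of `ln ξ = I(ξ r) - ξ r · ∇I(ξ r)`. The equation is read at points
`ξ r` around which `I` is finite and at which it is differentiable, so that both `I(ξ r)` and
`∇I(ξ r)` make sense. -/
structure IsXi {d : ℕ} (a : E d → ℝ) (r : E d) (ξ : ℝ) : Prop where
  pos : 0 < ξ
  finite : ∀ᶠ y in nhds (ξ • r), rate a y ≠ ⊤
  differentiable : DifferentiableAt ℝ (rateReal a) (ξ • r)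
  equation : Real.log ξ =
    rateReal a (ξ • r) - inner ℝ (ξ • r) (gradient (rateReal a) (ξ • r))

/-- The positive solution `ξ_r` of the above equation. -/
noncomputable def xi {d : ℕ} (a : E d → ℝ) (r : E d) : ℝ := Classical.epsilon (IsXi a r)

/-- `Φ(r) = 1 - (1 / ξ_r) (1 + ln ξ_r - I(ξ_r r))`. -/
noncomputable def Phi {d : ℕ} (a : E d → ℝ) (r : E d) : ℝ :=
  1 - 1 / xi a r * (1 + Real.log (xi a r) - rateReal a (xi a r • r))

/-- Condition `A₁`: `𝔼 exp(b₁ X · θ) = ∞` for all `b₁ > b` and all unit vectors `θ`. -/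
def CondA1 {d : ℕ} (a : E d → ℝ) (b : ℝ) : Prop :=
  ∀ b₁ : ℝ, b < b₁ → ∀ θ : E d, ‖θ‖ = 1 → expMoment a (b₁ • θ) = ∞

/-- Condition `A_p` (for `p > 1`): `L(γ) = C(b,p) |γ|^{p/(p-1)} (1 + o(1))` as `|γ| → ∞`, with
`C(b,p) = ((p-1)/p) (bp)^{-1/(p-1)}`. -/
def CondAp {d : ℕ} (a : E d → ℝ) (b p : ℝ) : Prop :=
  (∀ γ, cumulant a γ ≠ ⊤) ∧
  Asymptotics.IsEquivalent (Bornology.cobounded (E d)) (fun γ => (cumulant a γ).toReal)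
    (fun γ => (p - 1) / p * (b * p) ^ (-1 / (p - 1)) * ‖γ‖ ^ (p / (p - 1)))

/-- The support of `a` (as an element of `L^∞`) lies in the closed ball of radius `μ`. -/
def SuppInBall {d : ℕ} (a : E d → ℝ) (μ : ℝ) : Prop :=
  ∀ᵐ x : E d, μ < ‖x‖ → a x = 0

end NonlocalHeat

namespace NonlocalHeat

open MeasureTheory Set Filter Topology

variable {d : ℕ} {a : E d → ℝ} {C₁ b p : ℝ}

/-! The equation for `ξ` hides a Legendre transform. If `I` is differentiable at `s = ξ r` with
gradient `γ`, then `γ` attains `I(s) = γ · s - L(γ)`, so the equation reads `ln ξ = -L(γ)`, that is,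
`ξ = 1/Λ(γ)`. Thus `γ` maximises `η ↦ η · r/Λ(γ) - L(η)`. Because `Λ = exp L`, this is the same as
maximising `η ↦ η · r - Λ(η)`: formally both say `r = ∇Λ(γ)`, but the equivalence
(`IsDual.isExpDual`, `IsExpDual.isDual`) is proved by convexity alone, since `γ` may lie on the
boundary of the domain of `Λ`.

A maximiser of the second problem exists: `Λ` has a closed epigraph (Fatou) and, by evenness of `a`,
grows at least quadratically. It is unique because `L` is strictly convex. Conversely a maximiser
`γ` of `η · s - L(η)` is strict with a uniform gap, which makes `I` finite near `s` and
differentiable there. Hence `ξ_r` exists and is unique (`isXi_iff`), and substitution gives `Φ(r) =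
sup_γ (γ · r - Λ(γ) + 1)` (`Phi_eq`).

The rest estimates this supremum. Convexity is immediate. A trial `γ` gives a lower bound for `Φ`, a
lower bound for `Λ` gives an upper one. For the heat kernel, the Chernoff bound `a^{*k}(x) ≤ B
Λ(γ)^{k-1} e^{-γ·x}` sums over `k` to `B e^{-γ·x + t(Λ(γ)-1)}`, and the optimal `γ` produces the
exponent `-Φ(r) t`. -/

/-- The set of all `γ` with `𝔼 exp(γ · X) < ∞`. -/
def expDomain (a : E d → ℝ) : Set (E d) :=
  {γ | Integrable fun x => Real.exp (inner ℝ γ x) * a x}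

/-- The real-valued version of `expMoment`. -/
noncomputable def expMean (a : E d → ℝ) (γ : E d) : ℝ :=
  ∫ x, Real.exp (inner ℝ γ x) * a x

/-- The second moment `𝔼 (γ · X)²`. -/
noncomputable def secondMoment (a : E d → ℝ) (γ : E d) : ℝ :=
  ∫ x, (inner ℝ γ x : ℝ) ^ 2 * a x

/-! ### Exponential and second moments -/

theorem expMoment_eq_lintegral (ha : IsKernel a) (γ : E d) :
    expMoment a γ = ∫⁻ x, ENNReal.ofReal (Real.exp (inner ℝ γ x) * a x) := by
  unfold expMoment law
  rw [lintegral_withDensity_eq_lintegral_mul₀ ha.integrable.aemeasurable.ennreal_ofReal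
    (by fun_prop)]
  refine lintegral_congr fun x => ?_
  rw [Pi.mul_apply, mul_comm, ENNReal.ofReal_mul (Real.exp_pos _).le]

theorem expMoment_of_mem (ha : IsKernel a) {γ : E d} (h : γ ∈ expDomain a) :
    expMoment a γ = ENNReal.ofReal (expMean a γ) := by
  rw [expMoment_eq_lintegral ha, expMean, ofReal_integral_eq_lintegral_ofReal h]
  exact ae_of_all _ fun x => mul_nonneg (Real.exp_pos _).le (ha.nonneg x)

theorem aestronglyMeasurable_exp_mul (ha : IsKernel a) (γ : E d) :
    AEStronglyMeasurable (fun x => Real.exp (inner ℝ γ x) * a x) volume :=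
  (by fun_prop : Continuous fun x : E d => Real.exp (inner ℝ γ x)).aestronglyMeasurable.mul
    ha.integrable.aestronglyMeasurable

theorem mem_expDomain_iff (ha : IsKernel a) {γ : E d} :
    γ ∈ expDomain a ↔ expMoment a γ ≠ ⊤ := by
  rw [expMoment_eq_lintegral ha, ← lt_top_iff_ne_top]
  constructor
  · intro h
    exact (hasFiniteIntegral_iff_ofReal (ae_of_all _ fun x =>
      mul_nonneg (Real.exp_pos _).le (ha.nonneg x))).1 h.2
  · intro h
    exact ⟨aestronglyMeasurable_exp_mul ha γ, (hasFiniteIntegral_iff_ofReal (ae_of_all _ fun x =>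
      mul_nonneg (Real.exp_pos _).le (ha.nonneg x))).2 h⟩

/-- Fatou's lemma along the neighbourhood filter of `γ`. -/
theorem lowerSemicontinuous_expMoment (a : E d → ℝ) : LowerSemicontinuous (expMoment a) := by
  intro γ
  refine lowerSemicontinuousAt_iff_le_liminf.2 ?_
  have hc : ∀ x : E d, liminf (fun γ' : E d => ENNReal.ofReal (Real.exp (inner ℝ γ' x))) (𝓝 γ)
      = ENNReal.ofReal (Real.exp (inner ℝ γ x)) := fun x =>
    (ENNReal.continuous_ofReal.comp (by fun_prop : Continuous fun γ' : E d =>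
      Real.exp (inner ℝ γ' x))).continuousAt.liminf_eq
  calc expMoment a γ = ∫⁻ x, liminf (fun γ' : E d => ENNReal.ofReal (Real.exp (inner ℝ γ' x)))
        (𝓝 γ) ∂(law a) := by simp only [hc, expMoment]
    _ ≤ _ := lintegral_liminf_le fun γ' => by fun_prop

theorem zero_mem_expDomain (ha : IsKernel a) : (0 : E d) ∈ expDomain a := by
  simpa [expDomain] using ha.integrable

theorem expMean_zero (ha : IsKernel a) : expMean a 0 = 1 := by
  simpa [expMean] using ha.integral_eq_one

theorem neg_mem_expDomain (ha : IsKernel a) {γ : E d} (h : γ ∈ expDomain a) :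
    -γ ∈ expDomain a := by
  have h0 : Integrable fun x => Real.exp (inner ℝ γ x) * a x := h
  refine h0.comp_neg.congr (ae_of_all _ fun x => ?_)
  simp [ha.even]

theorem expMean_neg (ha : IsKernel a) (γ : E d) : expMean a (-γ) = expMean a γ := by
  unfold expMean
  rw [← integral_neg_eq_self]
  simp [ha.even]

theorem expMean_eq_integral_cosh (ha : IsKernel a) {γ : E d} (h : γ ∈ expDomain a) :
    Integrable (fun x => Real.cosh (inner ℝ γ x) * a x) ∧
      expMean a γ = ∫ x, Real.cosh (inner ℝ γ x) * a x := by
  have h' : Integrable fun x => Real.exp (inner ℝ (-γ) x) * a x := neg_mem_expDomain ha h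
  have h0 : Integrable fun x => Real.exp (inner ℝ γ x) * a x := h
  have e : (fun x => Real.cosh (inner ℝ γ x) * a x) = fun x =>
      (1 / 2 : ℝ) * (Real.exp (inner ℝ γ x) * a x + Real.exp (inner ℝ (-γ) x) * a x) := by
    funext x
    rw [Real.cosh_eq, inner_neg_left]; ring
  rw [e]
  refine ⟨(h0.add h').const_mul _, ?_⟩
  rw [integral_const_mul, integral_add h0 h']
  have := expMean_neg ha γ
  unfold expMean at *
  linarith

theorem integrable_inner_sq_mul (ha : IsKernel a) (γ : E d) :
    Integrable fun x => (inner ℝ γ x : ℝ) ^ 2 * a x := by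
  refine (ha.second_moment.const_mul (‖γ‖ ^ 2)).mono'
    ((by fun_prop : Continuous fun x : E d => (inner ℝ γ x : ℝ) ^ 2).aestronglyMeasurable.mul
    ha.integrable.aestronglyMeasurable) (ae_of_all _ fun x => ?_)
  rw [Real.norm_of_nonneg (mul_nonneg (sq_nonneg _) (ha.nonneg x)), ← mul_assoc, ← mul_pow]
  refine mul_le_mul_of_nonneg_right ?_ (ha.nonneg x)
  exact sq_le_sq' (neg_le_of_abs_le (abs_real_inner_le_norm γ x)) (real_inner_le_norm γ x)

theorem one_add_half_sq_le_cosh (u : ℝ) : 1 + u ^ 2 / 2 ≤ Real.cosh u := by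
  have h := Real.cosh_sq' (u / 2)
  have h2 : Real.cosh u = 1 + 2 * Real.sinh (u / 2) ^ 2 := by
    have := Real.cosh_two_mul (u / 2)
    rw [show 2 * (u / 2) = u by ring] at this
    linarith
  have h3 : (u / 2) ^ 2 ≤ Real.sinh (u / 2) ^ 2 := by
    rw [sq_le_sq]
    rw [Real.abs_sinh]
    exact Real.self_le_sinh_iff.2 (abs_nonneg _)
  nlinarith

/-- Evenness turns `exp` into `cosh`, which dominates its quadratic Taylor polynomial. This supplies
both the coercivity of `Λ` and the sharp upper bound for `Φ` near zero. -/
theorem one_add_half_secondMoment_le (ha : IsKernel a) {γ : E d} (h : γ ∈ expDomain a) :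
    1 + secondMoment a γ / 2 ≤ expMean a γ := by
  obtain ⟨hi, he⟩ := expMean_eq_integral_cosh ha h
  rw [he]
  have hq := integrable_inner_sq_mul ha γ
  calc 1 + secondMoment a γ / 2 = ∫ x, (a x + (1 / 2 : ℝ) * ((inner ℝ γ x : ℝ) ^ 2 * a x)) := by
        rw [integral_add ha.integrable (hq.const_mul _), integral_const_mul, ha.integral_eq_one,
          secondMoment]; ring
    _ ≤ _ := by
        refine integral_mono (ha.integrable.add (hq.const_mul _)) hi fun x => ?_
        have := mul_le_mul_of_nonneg_right (one_add_half_sq_le_cosh (inner ℝ γ x)) (ha.nonneg x)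
        simp only; linarith

theorem secondMoment_nonneg (ha : IsKernel a) (γ : E d) : 0 ≤ secondMoment a γ :=
  integral_nonneg fun x => mul_nonneg (sq_nonneg _) (ha.nonneg x)

theorem one_le_expMean (ha : IsKernel a) {γ : E d} (h : γ ∈ expDomain a) : 1 ≤ expMean a γ := by
  have := one_add_half_secondMoment_le ha h
  have := secondMoment_nonneg ha γ
  linarith

/-- A random vector with a density does not lie on a hyperplane. -/
theorem ae_inner_ne {v : E d} (hv : v ≠ 0) (c : ℝ) : ∀ᵐ x : E d, (inner ℝ v x : ℝ) ≠ c := by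
  let S : AffineSubspace ℝ (E d) := AffineSubspace.comap
    (innerₗ (E d) v).toAffineMap (AffineSubspace.mk' c ⊥)
  have hmem : ∀ x, x ∈ S ↔ (inner ℝ v x : ℝ) = c := fun x => by
    simp [S, AffineSubspace.mem_comap, AffineSubspace.mem_mk', sub_eq_zero]
  have hS : S ≠ ⊤ := by
    intro h
    have h0 : (0 : E d) ∈ S := h ▸ AffineSubspace.mem_top ℝ (E d) _
    have h1 : v ∈ S := h ▸ AffineSubspace.mem_top ℝ (E d) _
    rw [hmem] at h0 h1
    rw [inner_zero_right] at h0
    rw [← h0] at h1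
    exact hv (inner_self_eq_zero.1 h1)
  have := Measure.addHaar_affineSubspace (volume : Measure (E d)) S hS
  rw [ae_iff]
  convert this using 2
  ext x
  simp [hmem]

theorem exists_pos_of_ae (ha : IsKernel a) {P : E d → Prop} (hP : ∀ᵐ x, P x) :
    ¬ ∀ᵐ x, P x → a x = 0 := by
  intro h
  have : a =ᵐ[volume] 0 := by
    filter_upwards [hP, h] with x h1 h2 using h2 h1
  have h1 := ha.integral_eq_one
  rw [integral_congr_ae this] at h1
  simp at h1

theorem secondMoment_pos (ha : IsKernel a) {γ : E d} (hγ : γ ≠ 0) : 0 < secondMoment a γ := by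
  refine lt_of_le_of_ne (secondMoment_nonneg ha γ) fun h => ?_
  have h0 := (integral_eq_zero_iff_of_nonneg (fun x => mul_nonneg (sq_nonneg _) (ha.nonneg x))
    (integrable_inner_sq_mul ha γ)).1 h.symm
  refine exists_pos_of_ae ha (ae_inner_ne hγ 0) ?_
  filter_upwards [h0] with x hx hne
  simpa [hne] using hx

/-! ### Strict convexity and closed epigraph of the log-moment function -/

/-- `ln 𝔼 exp(γ · X)` as a real number. -/
noncomputable def logMean (a : E d → ℝ) (γ : E d) : ℝ := Real.log (expMean a γ)

theorem exp_logMean (ha : IsKernel a) {γ : E d} (h : γ ∈ expDomain a) :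
    Real.exp (logMean a γ) = expMean a γ :=
  Real.exp_log (lt_of_lt_of_le one_pos (one_le_expMean ha h))

theorem logMean_nonneg (ha : IsKernel a) {γ : E d} (h : γ ∈ expDomain a) : 0 ≤ logMean a γ :=
  Real.log_nonneg (one_le_expMean ha h)

theorem logMean_zero (ha : IsKernel a) : logMean a 0 = 0 := by
  rw [logMean, expMean_zero ha, Real.log_one]

/-- Convexity of `exp` is applied pointwise to the normalised exponents `γ · x - L(γ)` and `η · x -
L(η)`, then integrated. Equality would force `a = 0` wherever these exponents differ, hence off a
null hyperplane. -/
theorem strictConvexOn_logMean (ha : IsKernel a) : StrictConvexOn ℝ (expDomain a) (logMean a) := by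
  have key : ∀ γ ∈ expDomain a, ∀ η ∈ expDomain a, ∀ s t : ℝ, 0 ≤ s → 0 ≤ t → s + t = 1 →
      ∀ x, Real.exp (inner ℝ (s • γ + t • η) x) * a x ≤
        Real.exp (s * logMean a γ + t * logMean a η) *
        (s * (Real.exp (inner ℝ γ x) * a x / expMean a γ) +
          t * (Real.exp (inner ℝ η x) * a x / expMean a η)) := by
    intro γ hγ η hη s t hs ht hst x
    have hc := convexOn_exp.2 (mem_univ ((inner ℝ γ x : ℝ) - logMean a γ))
      (mem_univ ((inner ℝ η x : ℝ) - logMean a η)) hs ht hst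
    simp only [smul_eq_mul, Real.exp_sub, exp_logMean ha hγ, exp_logMean ha hη] at hc
    have e : Real.exp (inner ℝ (s • γ + t • η) x) =
        Real.exp (s * logMean a γ + t * logMean a η) *
        Real.exp (s * ((inner ℝ γ x : ℝ) - logMean a γ) + t * ((inner ℝ η x : ℝ) - logMean a η)) := by
      rw [← Real.exp_add, inner_add_left, inner_smul_left, inner_smul_left]
      congr 1; simp; ring
    rw [e, mul_assoc]
    refine mul_le_mul_of_nonneg_left ?_ (Real.exp_pos _).le
    refine (mul_le_mul_of_nonneg_right hc (ha.nonneg x)).trans (le_of_eq ?_)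
    ring
  have hint : ∀ γ ∈ expDomain a, ∀ η ∈ expDomain a, ∀ s t : ℝ,
      Integrable fun x => Real.exp (s * logMean a γ + t * logMean a η) *
        (s * (Real.exp (inner ℝ γ x) * a x / expMean a γ) +
          t * (Real.exp (inner ℝ η x) * a x / expMean a η)) := by
    intro γ hγ η hη s t
    have h1 : Integrable fun x => Real.exp (inner ℝ γ x) * a x := hγ
    have h2 : Integrable fun x => Real.exp (inner ℝ η x) * a x := hη
    exact (((h1.div_const _).const_mul _).add ((h2.div_const _).const_mul _)).const_mul _
  have hconv : Convex ℝ (expDomain a) := by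
    intro γ hγ η hη s t hs ht hst
    refine (hint γ hγ η hη s t).mono' (aestronglyMeasurable_exp_mul ha _) (ae_of_all _ fun x => ?_)
    rw [Real.norm_of_nonneg (mul_nonneg (Real.exp_pos _).le (ha.nonneg x))]
    exact key γ hγ η hη s t hs ht hst x
  refine ⟨hconv, ?_⟩
  intro γ hγ η hη hne s t hs ht hst
  have hm := hconv hγ hη hs.le ht.le hst
  have h1 : Integrable fun x => Real.exp (inner ℝ γ x) * a x := hγ
  have h2 : Integrable fun x => Real.exp (inner ℝ η x) * a x := hη
  have hMγ : 0 < expMean a γ := lt_of_lt_of_le one_pos (one_le_expMean ha hγ)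
  have hMη : 0 < expMean a η := lt_of_lt_of_le one_pos (one_le_expMean ha hη)
  have hI : ∫ x, Real.exp (s * logMean a γ + t * logMean a η) *
        (s * (Real.exp (inner ℝ γ x) * a x / expMean a γ) +
          t * (Real.exp (inner ℝ η x) * a x / expMean a η)) =
      Real.exp (s * logMean a γ + t * logMean a η) := by
    rw [integral_const_mul, integral_add ((h1.div_const _).const_mul _)
      ((h2.div_const _).const_mul _), integral_const_mul, integral_const_mul, integral_div,
      integral_div]
    change _ * (s * (expMean a γ / expMean a γ) + t * (expMean a η / expMean a η)) = _
    rw [div_self hMγ.ne', div_self hMη.ne', mul_one, mul_one, hst, mul_one]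
  have hle : expMean a (s • γ + t • η) ≤ Real.exp (s * logMean a γ + t * logMean a η) := by
    rw [← hI]
    exact integral_mono hm (hint γ hγ η hη s t) (key γ hγ η hη s t hs.le ht.le hst)
  have hlt : expMean a (s • γ + t • η) < Real.exp (s * logMean a γ + t * logMean a η) := by
    refine lt_of_le_of_ne hle fun heq => ?_
    rw [← hI] at heq
    have hae := (integral_eq_iff_of_ae_le hm (hint γ hγ η hη s t)
      (ae_of_all _ (key γ hγ η hη s t hs.le ht.le hst))).1 heq
    refine exists_pos_of_ae ha (ae_inner_ne (sub_ne_zero.2 hne) (logMean a γ - logMean a η)) ?_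
    filter_upwards [hae] with x hx hxne
    by_contra hax
    have hapos : 0 < a x := lt_of_le_of_ne (ha.nonneg x) (Ne.symm hax)
    have hc := strictConvexOn_exp.2 (mem_univ ((inner ℝ γ x : ℝ) - logMean a γ))
      (mem_univ ((inner ℝ η x : ℝ) - logMean a η))
      (by rw [inner_sub_left] at hxne; intro h; apply hxne; linarith) hs ht hst
    simp only [smul_eq_mul, Real.exp_sub, exp_logMean ha hγ, exp_logMean ha hη] at hc
    have e : Real.exp (inner ℝ (s • γ + t • η) x) =
        Real.exp (s * logMean a γ + t * logMean a η) *
        Real.exp (s * ((inner ℝ γ x : ℝ) - logMean a γ) + t * ((inner ℝ η x : ℝ) - logMean a η)) := by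
      rw [← Real.exp_add, inner_add_left, inner_smul_left, inner_smul_left]
      congr 1; simp; ring
    rw [e, mul_assoc] at hx
    have hx' := mul_left_cancel₀ (Real.exp_pos _).ne' hx
    have := mul_lt_mul_of_pos_right hc hapos
    rw [hx'] at this
    refine this.ne (by ring)
  have := Real.log_lt_log (lt_of_lt_of_le one_pos (one_le_expMean ha hm)) hlt
  rwa [Real.log_exp] at this

/-- This closedness replaces continuity in the compactness arguments, so nothing has to be known
about `logMean` at the boundary of its domain. -/
theorem isClosed_epigraph_logMean (ha : IsKernel a) :
    IsClosed {q : E d × ℝ | q.1 ∈ expDomain a ∧ logMean a q.1 ≤ q.2} := by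
  have h := (lowerSemicontinuous_expMoment a).isClosed_epigraph.preimage
    (f := fun q : E d × ℝ => (q.1, ENNReal.ofReal (Real.exp q.2)))
    (continuous_fst.prodMk (ENNReal.continuous_ofReal.comp (by fun_prop)))
  convert h using 1
  ext ⟨γ, c⟩
  simp only [mem_ofPred_eq, mem_preimage]
  constructor
  · rintro ⟨h1, h2⟩
    rw [expMoment_of_mem ha h1]
    apply ENNReal.ofReal_le_ofReal
    rw [← exp_logMean ha h1]
    exact Real.exp_le_exp.2 h2
  · intro h1
    have hD : γ ∈ expDomain a :=
      (mem_expDomain_iff ha).2 (h1.trans_lt ENNReal.ofReal_lt_top).ne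
    refine ⟨hD, ?_⟩
    rw [expMoment_of_mem ha hD, ENNReal.ofReal_le_ofReal_iff (Real.exp_pos _).le,
      ← exp_logMean ha hD, Real.exp_le_exp] at h1
    exact h1

/-! ### From the extended-real rate function to real inequalities -/

theorem cumulant_of_mem (ha : IsKernel a) {γ : E d} (h : γ ∈ expDomain a) :
    cumulant a γ = (logMean a γ : EReal) := by
  rw [cumulant, expMoment_of_mem ha h, logMean,
    ENNReal.log_ofReal_of_pos (lt_of_lt_of_le one_pos (one_le_expMean ha h))]

theorem cumulant_of_notMem (ha : IsKernel a) {γ : E d} (h : γ ∉ expDomain a) :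
    cumulant a γ = ⊤ := by
  rw [mem_expDomain_iff ha, not_not] at h
  rw [cumulant, h, ENNReal.log_top]

theorem rate_le_iff (ha : IsKernel a) {s : E d} {c : ℝ} :
    rate a s ≤ (c : EReal) ↔ ∀ γ ∈ expDomain a, (inner ℝ γ s : ℝ) - logMean a γ ≤ c := by
  rw [rate, iSup_le_iff]
  refine forall_congr' fun γ => ?_
  by_cases h : γ ∈ expDomain a
  · rw [cumulant_of_mem ha h, ← EReal.coe_sub, EReal.coe_le_coe_iff]
    simp [h]
  · rw [cumulant_of_notMem ha h]
    simp [h]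

theorem rate_ne_bot (ha : IsKernel a) (s : E d) : rate a s ≠ ⊥ := by
  intro h
  have := (rate_le_iff ha (s := s) (c := -1)).1 (by rw [h]; exact bot_le) 0 (zero_mem_expDomain ha)
  rw [logMean_zero ha, inner_zero_left] at this
  norm_num at this

theorem coe_rateReal (ha : IsKernel a) {s : E d} (h : rate a s ≠ ⊤) :
    (rateReal a s : EReal) = rate a s :=
  EReal.coe_toReal h (rate_ne_bot ha s)

theorem le_rateReal (ha : IsKernel a) {s : E d} (h : rate a s ≠ ⊤) {γ : E d}
    (hγ : γ ∈ expDomain a) : (inner ℝ γ s : ℝ) - logMean a γ ≤ rateReal a s :=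
  (rate_le_iff ha).1 (coe_rateReal ha h).ge γ hγ

theorem rateReal_le (ha : IsKernel a) {s : E d} {c : ℝ}
    (hc : ∀ γ ∈ expDomain a, (inner ℝ γ s : ℝ) - logMean a γ ≤ c) :
    rate a s ≠ ⊤ ∧ rateReal a s ≤ c := by
  have h := (rate_le_iff ha).2 hc
  have h' : rate a s ≠ ⊤ := (h.trans_lt (EReal.coe_lt_top c)).ne
  refine ⟨h', ?_⟩
  rwa [← coe_rateReal ha h', EReal.coe_le_coe_iff] at h

/-! ### Maximisers in the definition of `I` are gradients of `I` -/

/-- A point at which the supremum defining `I(s)` is attained. -/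
structure IsDual (a : E d → ℝ) (s γ₀ : E d) : Prop where
  mem : γ₀ ∈ expDomain a
  le : ∀ γ ∈ expDomain a,
    (inner ℝ γ s : ℝ) - logMean a γ ≤ (inner ℝ γ₀ s : ℝ) - logMean a γ₀

theorem IsDual.lt (ha : IsKernel a) {s γ₀ : E d} (h : IsDual a s γ₀) {γ : E d}
    (hγ : γ ∈ expDomain a) (hne : γ ≠ γ₀) :
    (inner ℝ γ s : ℝ) - logMean a γ < (inner ℝ γ₀ s : ℝ) - logMean a γ₀ := by
  have hs := (strictConvexOn_logMean ha).2 hγ h.mem hne (half_pos one_pos) (half_pos one_pos)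
    (add_halves (1 : ℝ))
  have hm := h.le _ ((strictConvexOn_logMean ha).1 hγ h.mem (half_pos one_pos).le
    (half_pos one_pos).le (add_halves (1 : ℝ)))
  rw [inner_add_left, inner_smul_left, inner_smul_left] at hm
  simp only [smul_eq_mul, RCLike.conj_to_real] at hs hm
  linarith

/-- The relevant part of the epigraph over the sphere is compact: the cutoff `m - 1` bounds its
height. The best point there is strictly worse than `γ₀`, and points below the cutoff lose at least
`1` anyway. -/
theorem IsDual.gap_sphere (ha : IsKernel a) {s γ₀ : E d} (h : IsDual a s γ₀) {ε : ℝ}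
    (hε : 0 < ε) : ∃ δ > 0, ∀ γ ∈ expDomain a, ‖γ - γ₀‖ = ε →
      (inner ℝ γ s : ℝ) - logMean a γ ≤ (inner ℝ γ₀ s : ℝ) - logMean a γ₀ - δ := by
  set m : ℝ := (inner ℝ γ₀ s : ℝ) - logMean a γ₀ with hm
  let K : Set (E d × ℝ) := {q | q.1 ∈ expDomain a ∧ logMean a q.1 ≤ q.2} ∩
    {q | ‖q.1 - γ₀‖ = ε ∧ m - 1 ≤ (inner ℝ q.1 s : ℝ) - q.2}
  have hK : IsCompact K := by
    have hcl : IsClosed K := (isClosed_epigraph_logMean ha).inter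
      ((isClosed_eq (f := fun q : E d × ℝ => ‖q.1 - γ₀‖) (by fun_prop) continuous_const).inter
        (isClosed_le (f := fun _ : E d × ℝ => m - 1)
          (g := fun q => (inner ℝ q.1 s : ℝ) - q.2) continuous_const (by fun_prop)))
    refine IsCompact.of_isClosed_subset ((isCompact_closedBall γ₀ ε).prod
      (isCompact_Icc (a := 0) (b := (‖γ₀‖ + ε) * ‖s‖ - m + 1))) hcl ?_
    rintro ⟨γ, c⟩ ⟨⟨h1, h2⟩, h3, h4⟩
    simp only at h1 h2 h3 h4
    refine ⟨by simp [dist_eq_norm, h3], (logMean_nonneg ha h1).trans h2, ?_⟩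
    have h5 := real_inner_le_norm γ s
    have h6 : ‖γ‖ ≤ ‖γ₀‖ + ε := by
      have := norm_add_le γ₀ (γ - γ₀)
      rwa [add_sub_cancel, h3] at this
    have := mul_le_mul_of_nonneg_right h6 (norm_nonneg s)
    simp only
    linarith
  rcases K.eq_empty_or_nonempty with hemp | hne
  · refine ⟨1, one_pos, fun γ hγ hγε => ?_⟩
    by_contra! hlt
    have : (γ, logMean a γ) ∈ K := ⟨⟨hγ, le_rfl⟩, hγε, hlt.le⟩
    rw [hemp] at this
    exact this
  · obtain ⟨⟨γ₁, c₁⟩, hq, hmax⟩ := hK.exists_isMaxOn hne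
      (f := fun q : E d × ℝ => (inner ℝ q.1 s : ℝ) - q.2) (by fun_prop)
    obtain ⟨⟨h1, h2⟩, h3, h4⟩ := hq
    simp only at h1 h2 h3 h4
    have hne : γ₁ ≠ γ₀ := by
      rintro rfl
      simp at h3
      exact hε.ne h3
    have hlt := h.lt ha h1 hne
    refine ⟨min 1 (m - ((inner ℝ γ₁ s : ℝ) - logMean a γ₁)), lt_min one_pos (sub_pos.2 hlt),
      fun γ hγ hγε => ?_⟩
    by_cases hc : m - 1 ≤ (inner ℝ γ s : ℝ) - logMean a γ
    · have h5 := hmax (show (γ, logMean a γ) ∈ K from ⟨⟨hγ, le_rfl⟩, hγε, hc⟩)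
      simp only [mem_ofPred_eq] at h5
      have := min_le_right 1 (m - ((inner ℝ γ₁ s : ℝ) - logMean a γ₁))
      linarith
    · have := min_le_left 1 (m - ((inner ℝ γ₁ s : ℝ) - logMean a γ₁))
      linarith

/-- By concavity along the segment from `γ₀`, the gap on the sphere of radius `ε` grows at least
linearly beyond it. -/
theorem IsDual.gap (ha : IsKernel a) {s γ₀ : E d} (h : IsDual a s γ₀) {ε : ℝ}
    (hε : 0 < ε) : ∃ δ > 0, ∀ γ ∈ expDomain a, ε ≤ ‖γ - γ₀‖ →
      (inner ℝ γ s : ℝ) - logMean a γ ≤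
        (inner ℝ γ₀ s : ℝ) - logMean a γ₀ - δ * ‖γ - γ₀‖ := by
  obtain ⟨δ, hδ, H⟩ := h.gap_sphere ha hε
  refine ⟨δ / ε, by positivity, fun γ hγ hγε => ?_⟩
  have hn : 0 < ‖γ - γ₀‖ := hε.trans_le hγε
  set t := ε / ‖γ - γ₀‖ with ht
  have ht0 : 0 < t := by positivity
  have ht1 : t ≤ 1 := (div_le_one hn).2 hγε
  have hc := (strictConvexOn_logMean ha).convexOn.2 h.mem hγ (sub_nonneg.2 ht1) ht0.le (by ring)
  have hmem := (strictConvexOn_logMean ha).1 h.mem hγ (sub_nonneg.2 ht1) ht0.le (by ring)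
  have hs := H _ hmem (by
    rw [show (1 - t) • γ₀ + t • γ - γ₀ = t • (γ - γ₀) by module, norm_smul, Real.norm_of_nonneg ht0.le,
      ht, div_mul_cancel₀ _ hn.ne'])
  rw [inner_add_left, inner_smul_left, inner_smul_left] at hs
  simp only [smul_eq_mul, RCLike.conj_to_real] at hs hc
  have h1 : δ ≤ t * ((inner ℝ γ₀ s : ℝ) - logMean a γ₀ - ((inner ℝ γ s : ℝ) - logMean a γ)) := by
    nlinarith
  have h2 : δ / ε * ‖γ - γ₀‖ = δ / t := by rw [ht]; field_simp
  have h3 : δ / t ≤ (inner ℝ γ₀ s : ℝ) - logMean a γ₀ - ((inner ℝ γ s : ℝ) - logMean a γ) := by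
    rw [div_le_iff₀ ht0]; linarith
  linarith

theorem IsDual.rateReal_eq (ha : IsKernel a) {s γ₀ : E d} (h : IsDual a s γ₀) :
    rateReal a s = (inner ℝ γ₀ s : ℝ) - logMean a γ₀ := by
  obtain ⟨h1, h2⟩ := rateReal_le ha h.le
  exact le_antisymm h2 (le_rateReal ha h1 h.mem)

/-- Moving `s` to `y` changes the objective by `(γ - γ₀) · (y - s)` beyond the linear term. Within
`ε` of `γ₀` this costs at most `ε ‖y - s‖`; farther away the linear gap absorbs it. The opposite
half of differentiability is just the trial point `γ₀`. -/
theorem IsDual.rateReal_add_le (ha : IsKernel a) {s γ₀ : E d} (h : IsDual a s γ₀) {ε : ℝ}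
    (hε : 0 < ε) : ∀ᶠ y in 𝓝 s, rate a y ≠ ⊤ ∧
      rateReal a y ≤ rateReal a s + inner ℝ γ₀ (y - s) + ε * ‖y - s‖ := by
  obtain ⟨δ, hδ, H⟩ := h.gap ha hε
  filter_upwards [Metric.ball_mem_nhds s hδ] with y hy
  rw [Metric.mem_ball, dist_eq_norm] at hy
  refine rateReal_le ha fun γ hγ => ?_
  have e : (inner ℝ γ y : ℝ) = inner ℝ γ s + inner ℝ γ₀ (y - s) + inner ℝ (γ - γ₀) (y - s) := by
    rw [inner_sub_left]; simp only [inner_sub_right]; ring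
  have h1 := real_inner_le_norm (γ - γ₀) (y - s)
  have h2 := h.le γ hγ
  rw [h.rateReal_eq ha, e]
  rcases le_total ε ‖γ - γ₀‖ with h3 | h3
  · have h4 := H γ hγ h3
    have h5 := mul_le_mul_of_nonneg_right hy.le (norm_nonneg (γ - γ₀))
    have h6 : 0 ≤ ε * ‖y - s‖ := by positivity
    linarith
  · have h5 := mul_le_mul_of_nonneg_right h3 (norm_nonneg (y - s))
    linarith

theorem IsDual.eventually_rate_ne_top (ha : IsKernel a) {s γ₀ : E d} (h : IsDual a s γ₀) :
    ∀ᶠ y in 𝓝 s, rate a y ≠ ⊤ :=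
  (h.rateReal_add_le ha one_pos).mono fun _ hy => hy.1

theorem IsDual.hasGradientAt (ha : IsKernel a) {s γ₀ : E d} (h : IsDual a s γ₀) :
    HasGradientAt (rateReal a) γ₀ s := by
  rw [hasGradientAt_iff_isLittleO, Asymptotics.isLittleO_iff]
  intro ε hε
  filter_upwards [h.rateReal_add_le ha hε] with y ⟨hy1, hy2⟩
  have h1 := le_rateReal ha hy1 h.mem
  have h2 := h.rateReal_eq ha
  rw [Real.norm_eq_abs, abs_le]
  have h3 : 0 ≤ ε * ‖y - s‖ := by positivity
  have h4 : (inner ℝ γ₀ (y - s) : ℝ) = inner ℝ γ₀ y - inner ℝ γ₀ s := inner_sub_right _ _ _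
  constructor <;> linarith

/-- At a point of differentiability of `I`, the gradient attains the supremum. -/
theorem isDual_of_hasGradientAt (ha : IsKernel a) {s γ : E d}
    (hfin : ∀ᶠ y in 𝓝 s, rate a y ≠ ⊤) (hγ : HasGradientAt (rateReal a) γ s) : IsDual a s γ := by
  have hs : rate a s ≠ ⊤ := hfin.self_of_nhds
  have hex : ∀ n : ℕ, ∃ η ∈ expDomain a,
      rateReal a s - 1 / ((n : ℝ) + 1) < (inner ℝ η s : ℝ) - logMean a η := by
    intro n
    by_contra! hcon
    have := (rateReal_le ha hcon).2
    have : 0 < 1 / ((n : ℝ) + 1) := by positivity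
    linarith
  choose η hη hηs using hex
  have hlim0 : Tendsto (fun n : ℕ => 1 / ((n : ℝ) + 1)) atTop (𝓝 0) :=
    tendsto_one_div_add_atTop_nhds_zero_nat
  have hlim : Tendsto η atTop (𝓝 γ) := by
    rw [Metric.tendsto_atTop']
    intro ε hε
    rw [hasGradientAt_iff_isLittleO, Asymptotics.isLittleO_iff] at hγ
    obtain ⟨ρ, hρ, H⟩ := Metric.eventually_nhds_iff.1 ((hγ (half_pos hε)).and hfin)
    have hsmall : ∀ᶠ n : ℕ in atTop, 1 / ((n : ℝ) + 1) < ρ / 2 * (ε / 2) :=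
      hlim0.eventually (gt_mem_nhds (by positivity))
    obtain ⟨N, hN⟩ := eventually_atTop.1 hsmall
    refine ⟨N, fun n hn => ?_⟩
    have hNn := hN n hn.le
    rw [dist_eq_norm]
    by_contra! hge
    have hpos : 0 < ‖η n - γ‖ := hε.trans_le hge
    -- Testing `I` at distance `ρ / 2` from `s` in the direction `η n - γ`: the affine minorant
    -- given by `η n` would rise faster there than the gradient `γ` allows.
    set u : E d := (ρ / 2 / ‖η n - γ‖) • (η n - γ) with hu
    have hun : ‖u‖ = ρ / 2 := by
      rw [hu, norm_smul, Real.norm_of_nonneg (by positivity), div_mul_cancel₀ _ hpos.ne']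
    obtain ⟨h1, h2⟩ := H (y := s + u) (by rw [dist_eq_norm, add_sub_cancel_left, hun]; linarith)
    rw [add_sub_cancel_left, hun, Real.norm_eq_abs] at h1
    have h3 := (abs_le.1 h1).2
    have h4 := le_rateReal ha h2 (hη n)
    rw [inner_add_right] at h4
    have h5 : (inner ℝ (η n) u : ℝ) - inner ℝ γ u = ρ / 2 * ‖η n - γ‖ := by
      rw [← inner_sub_left, hu, inner_smul_right, real_inner_self_eq_norm_sq]
      field_simp
    have h6 := hηs n
    have h7 := mul_le_mul_of_nonneg_left hge (half_pos hρ).le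
    linarith
  have hcl := (isClosed_epigraph_logMean ha).mem_of_tendsto
    (f := fun n => (η n, (inner ℝ (η n) s : ℝ) - rateReal a s + 1 / ((n : ℝ) + 1)))
    (x := (γ, (inner ℝ γ s : ℝ) - rateReal a s + 0)) (b := atTop)
    (hlim.prodMk_nhds (((hlim.inner tendsto_const_nhds).sub_const _).add hlim0))
    (Eventually.of_forall fun n => ⟨hη n, by have := hηs n; simp only; linarith⟩)
  obtain ⟨h1, h2⟩ := hcl
  refine ⟨h1, fun γ' hγ' => ?_⟩
  have := le_rateReal ha hs hγ'
  simp only at h2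
  linarith

/-! ### Passing between `L` and `Λ`, and solving the equation for `ξ` -/

/-- A point at which the supremum of `γ · r - Λ(γ)` is attained. -/
structure IsExpDual (a : E d → ℝ) (r γ₀ : E d) : Prop where
  mem : γ₀ ∈ expDomain a
  le : ∀ γ ∈ expDomain a,
    (inner ℝ γ r : ℝ) - expMean a γ ≤ (inner ℝ γ₀ r : ℝ) - expMean a γ₀

theorem IsDual.isExpDual (ha : IsKernel a) {r γ₀ : E d}
    (h : IsDual a ((expMean a γ₀)⁻¹ • r) γ₀) : IsExpDual a r γ₀ := by
  have hM : 0 < expMean a γ₀ := one_pos.trans_le (one_le_expMean ha h.mem)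
  refine ⟨h.mem, fun γ hγ => ?_⟩
  have h1 := h.le γ hγ
  rw [inner_smul_right, inner_smul_right] at h1
  set w : ℝ := (expMean a γ₀)⁻¹ * inner ℝ γ r - (expMean a γ₀)⁻¹ * inner ℝ γ₀ r with hw
  have h2 : Real.exp w ≤ expMean a γ / expMean a γ₀ := by
    rw [← exp_logMean ha hγ, ← exp_logMean ha h.mem, ← Real.exp_sub]
    exact Real.exp_le_exp.2 (by linarith)
  have h3 : 1 + w ≤ expMean a γ / expMean a γ₀ := by
    have := Real.add_one_le_exp w
    linarith
  rw [le_div_iff₀ hM] at h3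
  have h4 : w * expMean a γ₀ = inner ℝ γ r - inner ℝ γ₀ r := by rw [hw]; field_simp
  linarith

/-- Both sides agree at `t = 0`, so their right derivatives there are ordered. -/
theorem le_of_one_add_mul_le_exp {D w : ℝ}
    (h : ∀ t : ℝ, 0 < t → t ≤ 1 → 1 + t * w ≤ Real.exp (t * D)) : w ≤ D := by
  have hd : HasDerivAt (fun t : ℝ => Real.exp (t * D)) D 0 := by
    have := ((hasDerivAt_id (0 : ℝ)).mul_const D).exp
    simpa using this
  have ht := hd.tendsto_slope_zero_right
  refine ge_of_tendsto ht ?_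
  filter_upwards [Ioc_mem_nhdsGT (zero_lt_one (α := ℝ))] with t ⟨h0, h1⟩
  have := h t h0 h1
  simp only [zero_add, zero_mul, Real.exp_zero, smul_eq_mul]
  rw [inv_mul_eq_div, le_div_iff₀ h0]
  linarith

/-- Replacing `exp L` by `L` is only a first-order comparison at `γ₀`, so the maximality is used
along the segment towards `γ`, near its start. -/
theorem IsExpDual.isDual (ha : IsKernel a) {r γ₀ : E d} (h : IsExpDual a r γ₀) :
    IsDual a ((expMean a γ₀)⁻¹ • r) γ₀ := by
  have hM : 0 < expMean a γ₀ := one_pos.trans_le (one_le_expMean ha h.mem)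
  refine ⟨h.mem, fun γ hγ => ?_⟩
  rw [inner_smul_right, inner_smul_right]
  suffices H : (expMean a γ₀)⁻¹ * ((inner ℝ γ r : ℝ) - inner ℝ γ₀ r) ≤
      logMean a γ - logMean a γ₀ by linarith
  refine le_of_one_add_mul_le_exp fun t ht0 ht1 => ?_
  have hc := (strictConvexOn_logMean ha).convexOn.2 h.mem hγ (sub_nonneg.2 ht1) ht0.le (by ring)
  have hmem := (strictConvexOn_logMean ha).1 h.mem hγ (sub_nonneg.2 ht1) ht0.le (by ring)
  have h1 := h.le _ hmem
  rw [inner_add_left, inner_smul_left, inner_smul_left] at h1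
  simp only [smul_eq_mul, RCLike.conj_to_real] at hc h1
  have h2 : Real.exp (t * (logMean a γ - logMean a γ₀)) * expMean a γ₀ ≥
      expMean a ((1 - t) • γ₀ + t • γ) := by
    rw [← exp_logMean ha hmem, ← exp_logMean ha h.mem, ← Real.exp_add]
    exact Real.exp_le_exp.2 (by linarith)
  have h3 : (1 + t * ((expMean a γ₀)⁻¹ * ((inner ℝ γ r : ℝ) - inner ℝ γ₀ r))) * expMean a γ₀ =
      expMean a γ₀ + t * ((inner ℝ γ r : ℝ) - inner ℝ γ₀ r) := by field_simp
  refine le_of_mul_le_mul_right ?_ hM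
  rw [h3]
  linarith

theorem secondMoment_smul (c : ℝ) (γ : E d) :
    secondMoment a (c • γ) = c ^ 2 * secondMoment a γ := by
  unfold secondMoment
  rw [← integral_const_mul]
  refine integral_congr_ae (ae_of_all _ fun x => ?_)
  simp only [inner_smul_left, RCLike.conj_to_real]
  ring

theorem continuous_secondMoment (ha : IsKernel a) : Continuous (secondMoment a) := by
  refine continuous_iff_continuousAt.2 fun γ => ?_
  refine continuousAt_of_dominated (F := fun γ x => (inner ℝ γ x : ℝ) ^ 2 * a x)
    (bound := fun x => (‖γ‖ + 1) ^ 2 * (‖x‖ ^ 2 * a x))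
    (Eventually.of_forall fun η => (integrable_inner_sq_mul ha η).aestronglyMeasurable) ?_
    (ha.second_moment.const_mul _) (ae_of_all _ fun x => by fun_prop)
  filter_upwards [Metric.ball_mem_nhds γ one_pos] with η hη
  refine ae_of_all _ fun x => ?_
  rw [Metric.mem_ball, dist_eq_norm] at hη
  have hn : ‖η‖ ≤ ‖γ‖ + 1 := by
    have := norm_add_le γ (η - γ)
    rw [add_sub_cancel] at this
    linarith
  rw [Real.norm_of_nonneg (mul_nonneg (sq_nonneg _) (ha.nonneg x)), ← mul_assoc, ← mul_pow]
  refine mul_le_mul_of_nonneg_right ?_ (ha.nonneg x)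
  rw [← sq_abs]
  refine pow_le_pow_left₀ (abs_nonneg _) ((abs_real_inner_le_norm η x).trans ?_) 2
  exact mul_le_mul_of_nonneg_right hn (norm_nonneg x)

theorem exists_le_secondMoment (ha : IsKernel a) :
    ∃ κ > 0, ∀ γ : E d, κ * ‖γ‖ ^ 2 ≤ secondMoment a γ := by
  -- The sphere is empty exactly in dimension zero, which is not excluded here.
  rcases (Metric.sphere (0 : E d) 1).eq_empty_or_nonempty with hemp | hne
  · refine ⟨1, one_pos, fun γ => ?_⟩
    by_cases hγ : γ = 0
    · simp [hγ, secondMoment_nonneg ha]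
    · have : (‖γ‖⁻¹ • γ) ∈ Metric.sphere (0 : E d) 1 := by
        simp [norm_smul, hγ]
      rw [hemp] at this
      exact this.elim
  · obtain ⟨θ, hθ, hmin⟩ := (isCompact_sphere (0 : E d) 1).exists_isMinOn hne
      (continuous_secondMoment ha).continuousOn
    have hθ0 : θ ≠ 0 := by
      rintro rfl
      simp at hθ
    refine ⟨secondMoment a θ, secondMoment_pos ha hθ0, fun γ => ?_⟩
    by_cases hγ : γ = 0
    · simp [hγ, secondMoment_nonneg ha]
    · have h1 : (‖γ‖⁻¹ • γ) ∈ Metric.sphere (0 : E d) 1 := by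
        simp [norm_smul, hγ]
      have h2 : secondMoment a θ ≤ secondMoment a (‖γ‖⁻¹ • γ) := hmin h1
      rw [secondMoment_smul, inv_pow, inv_mul_eq_div, le_div_iff₀ (pow_pos (norm_pos_iff.2 hγ) 2)] at h2
      exact h2

/-- The value at the origin is `-1`, so only points with at least this value compete. Quadratic
growth of `Λ` confines them to a ball, and the maximum is taken over the compact piece of the
epigraph of `L` above it. -/
theorem exists_isExpDual (ha : IsKernel a) (r : E d) : ∃ γ₀, IsExpDual a r γ₀ := by
  obtain ⟨κ, hκ, hκle⟩ := exists_le_secondMoment ha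
  let K : Set (E d × ℝ) := {q | q.1 ∈ expDomain a ∧ logMean a q.1 ≤ q.2} ∩
    {q | -1 ≤ (inner ℝ q.1 r : ℝ) - Real.exp q.2}
  have hcl : IsClosed K := (isClosed_epigraph_logMean ha).inter
    (isClosed_le (by fun_prop) (by fun_prop))
  have hK : IsCompact K := by
    refine IsCompact.of_isClosed_subset ((isCompact_closedBall (0 : E d) (2 * ‖r‖ / κ)).prod
      (isCompact_Icc (a := 0) (b := (2 * ‖r‖ / κ) * ‖r‖))) hcl ?_
    rintro ⟨γ, c⟩ ⟨⟨h1, h2⟩, h3⟩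
    simp only [mem_ofPred_eq] at h1 h2 h3
    have h4 := one_add_half_secondMoment_le ha h1
    have h5 := hκle γ
    have h6 := Real.exp_le_exp.2 h2
    rw [exp_logMean ha h1] at h6
    have h7 := real_inner_le_norm γ r
    have h8 : ‖γ‖ ≤ 2 * ‖r‖ / κ := by
      rw [le_div_iff₀ hκ]
      rcases (norm_nonneg γ).eq_or_lt with h0 | h0
      · rw [← h0]; rw [zero_mul]; positivity
      · refine le_of_mul_le_mul_left ?_ h0
        nlinarith
    refine ⟨by simpa using h8, (logMean_nonneg ha h1).trans h2, ?_⟩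
    have h9 := Real.add_one_le_exp c
    have := mul_le_mul_of_nonneg_right h8 (norm_nonneg r)
    simp only
    linarith
  have hz : ((0 : E d), (0 : ℝ)) ∈ K :=
    ⟨⟨zero_mem_expDomain ha, (logMean_zero ha).le⟩, by simp⟩
  obtain ⟨⟨γ₀, c₀⟩, hq, hmax⟩ := hK.exists_isMaxOn ⟨_, hz⟩
    (f := fun q : E d × ℝ => (inner ℝ q.1 r : ℝ) - Real.exp q.2) (by fun_prop)
  obtain ⟨⟨h1, h2⟩, h3⟩ := hq
  simp only [mem_ofPred_eq] at h1 h2 h3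
  refine ⟨γ₀, h1, fun γ hγ => ?_⟩
  have h6 := Real.exp_le_exp.2 h2
  rw [exp_logMean ha h1] at h6
  by_cases hc : -1 ≤ (inner ℝ γ r : ℝ) - expMean a γ
  · have h5 := hmax (show (γ, logMean a γ) ∈ K from
      ⟨⟨hγ, le_rfl⟩, by simpa [exp_logMean ha hγ] using hc⟩)
    simp only [mem_ofPred_eq, exp_logMean ha hγ] at h5
    linarith
  · linarith

theorem isXi_iff (ha : IsKernel a) {r γ₀ : E d} (h : IsExpDual a r γ₀) (ξ : ℝ) :
    IsXi a r ξ ↔ ξ = (expMean a γ₀)⁻¹ := by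
  have key : ∀ γ : E d, ∀ η : ℝ, IsDual a (η • r) γ →
      (rateReal a (η • r) - inner ℝ (η • r) γ) = -logMean a γ := fun γ η hγ => by
    rw [hγ.rateReal_eq ha, real_inner_comm]; ring
  constructor
  · intro hξ
    have hg := hξ.differentiable.hasGradientAt
    have hD := isDual_of_hasGradientAt ha hξ.finite hg
    have heq := hξ.equation
    rw [key _ _ hD] at heq
    set γ := gradient (rateReal a) (ξ • r)
    have hξe : ξ = (expMean a γ)⁻¹ := by
      rw [← Real.exp_log hξ.pos, heq, Real.exp_neg, exp_logMean ha hD.mem]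
    have hγ : IsExpDual a r γ := IsDual.isExpDual ha (hξe ▸ hD)
    have h1 := h.le γ hγ.mem
    have h2 := hγ.le γ₀ h.mem
    suffices γ = γ₀ by rw [hξe, this]
    -- Strict convexity of `L` passes to `Λ = exp L`, so two distinct maximisers would be beaten by
    -- their midpoint.
    by_contra hne
    have hmem := (strictConvexOn_logMean ha).1 hD.mem h.mem (half_pos one_pos).le
      (half_pos one_pos).le (add_halves (1 : ℝ))
    have h3 := hγ.le _ hmem
    have hcv := (strictConvexOn_logMean ha).2 hD.mem h.mem hne (half_pos one_pos)
      (half_pos one_pos) (add_halves (1 : ℝ))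
    have hlt := Real.exp_lt_exp.2 hcv
    rw [exp_logMean ha hmem] at hlt
    have hce := convexOn_exp.2 (mem_univ (logMean a γ)) (mem_univ (logMean a γ₀))
      (half_pos one_pos).le (half_pos one_pos).le (add_halves (1 : ℝ))
    rw [exp_logMean ha hD.mem, exp_logMean ha h.mem] at hce
    rw [inner_add_left, inner_smul_left, inner_smul_left] at h3
    simp only [smul_eq_mul, RCLike.conj_to_real] at hce h3 hlt
    linarith
  · rintro rfl
    have hM : 0 < expMean a γ₀ := one_pos.trans_le (one_le_expMean ha h.mem)
    have hD := h.isDual ha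
    have hg := hD.hasGradientAt ha
    refine ⟨inv_pos.2 hM, hD.eventually_rate_ne_top ha, hg.differentiableAt, ?_⟩
    rw [hg.gradient, key _ _ hD, Real.log_inv, logMean]

theorem xi_eq (ha : IsKernel a) {r γ₀ : E d} (h : IsExpDual a r γ₀) :
    xi a r = (expMean a γ₀)⁻¹ :=
  (isXi_iff ha h _).1 (Classical.epsilon_spec ⟨_, (isXi_iff ha h _).2 rfl⟩)

theorem existsUnique_isXi (ha : IsKernel a) (r : E d) : ∃! ξ : ℝ, IsXi a r ξ := by
  obtain ⟨γ₀, h⟩ := exists_isExpDual ha r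
  simp only [isXi_iff ha h]
  exact existsUnique_eq

/-! ### `Φ` as a Legendre transform -/

/-- `Φ` is the Legendre transform of `Λ - 1`. -/
theorem Phi_eq (ha : IsKernel a) {r γ₀ : E d} (h : IsExpDual a r γ₀) :
    Phi a r = (inner ℝ γ₀ r : ℝ) - expMean a γ₀ + 1 := by
  have hM : 0 < expMean a γ₀ := one_pos.trans_le (one_le_expMean ha h.mem)
  have hD := h.isDual ha
  rw [Phi, xi_eq ha h, hD.rateReal_eq ha, inner_smul_right, Real.log_inv, logMean]
  field_simp
  ring

theorem le_Phi (ha : IsKernel a) (r : E d) {γ : E d} (hγ : γ ∈ expDomain a) :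
    (inner ℝ γ r : ℝ) - expMean a γ + 1 ≤ Phi a r := by
  obtain ⟨γ₀, h⟩ := exists_isExpDual ha r
  rw [Phi_eq ha h]
  linarith [h.le γ hγ]

theorem Phi_le (ha : IsKernel a) {r : E d} {c : ℝ}
    (hc : ∀ γ ∈ expDomain a, (inner ℝ γ r : ℝ) - expMean a γ + 1 ≤ c) : Phi a r ≤ c := by
  obtain ⟨γ₀, h⟩ := exists_isExpDual ha r
  rw [Phi_eq ha h]
  exact hc _ h.mem

theorem Phi_nonneg (ha : IsKernel a) (r : E d) : 0 ≤ Phi a r := by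
  have := le_Phi ha r (zero_mem_expDomain ha)
  rwa [inner_zero_left, expMean_zero ha, zero_sub, neg_add_cancel] at this

theorem Phi_zero (ha : IsKernel a) : Phi a 0 = 0 := by
  refine le_antisymm (Phi_le ha fun γ hγ => ?_) (Phi_nonneg ha 0)
  rw [inner_zero_right]
  linarith [one_le_expMean ha hγ]

theorem convexOn_Phi (ha : IsKernel a) : ConvexOn ℝ univ (Phi a) := by
  refine ⟨convex_univ, fun r _ r' _ s t hs ht hst => Phi_le ha fun γ hγ => ?_⟩
  have h1 := mul_le_mul_of_nonneg_left (le_Phi ha r hγ) hs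
  have h2 := mul_le_mul_of_nonneg_left (le_Phi ha r' hγ) ht
  rw [inner_add_right, inner_smul_right, inner_smul_right]
  simp only [smul_eq_mul]
  calc _ = s * ((inner ℝ γ r : ℝ) - expMean a γ + 1) + t * ((inner ℝ γ r' : ℝ) - expMean a γ + 1)
        := by linear_combination (expMean a γ - 1) * hst
    _ ≤ _ := add_le_add h1 h2

/-! ### Consequences of the light tail -/

theorem LightTail.nonneg (ha : IsKernel a) (h : LightTail a C₁ b p) : 0 ≤ C₁ :=
  nonneg_of_mul_nonneg_left ((ha.nonneg 0).trans (h 0)) (Real.exp_pos _)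

theorem LightTail.exponential (ha : IsKernel a) (h : LightTail a C₁ b p) (hb : 0 < b)
    (hp : 1 ≤ p) (x : E d) : a x ≤ C₁ * Real.exp b * Real.exp (-b * ‖x‖) := by
  refine (h x).trans ?_
  rw [mul_assoc, ← Real.exp_add]
  refine mul_le_mul_of_nonneg_left (Real.exp_le_exp.2 ?_) (h.nonneg ha)
  have h1 : ‖x‖ ≤ ‖x‖ ^ p + 1 := by
    rcases le_total ‖x‖ 1 with h1 | h1
    · have := Real.rpow_nonneg (norm_nonneg x) p
      linarith
    · have := Real.self_le_rpow_of_one_le h1 hp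
      linarith
  nlinarith

theorem integrable_exp_neg_mul_norm {c : ℝ} (hc : 0 < c) :
    Integrable fun x : E d => Real.exp (-c * ‖x‖) := by
  have hd : (Module.finrank ℝ (E d) : ℝ) < ((d + 1 : ℕ) : ℝ) := by
    rw [finrank_euclideanSpace_fin]; push_cast; linarith
  refine ((integrable_one_add_norm (μ := (volume : Measure (E d))) hd).const_mul
    ((d + 1).factorial * Real.exp c / c ^ (d + 1))).mono'
    (by fun_prop : Continuous fun x : E d => Real.exp (-c * ‖x‖)).aestronglyMeasurable
    (ae_of_all _ fun x => ?_)
  rw [Real.norm_of_nonneg (Real.exp_pos _).le, Real.rpow_neg (by positivity), Real.rpow_natCast]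
  have h := Real.pow_div_factorial_le_exp (c * (1 + ‖x‖)) (by positivity) (d + 1)
  rw [mul_add, mul_one, Real.exp_add, ← mul_one_add, mul_pow] at h
  rw [neg_mul, Real.exp_neg, ← div_eq_mul_inv, le_div_iff₀ (by positivity),
    inv_mul_le_iff₀ (Real.exp_pos _), mul_div_assoc']
  rw [div_le_iff₀ (by positivity)] at h
  rw [le_div_iff₀ (by positivity)]
  linarith

theorem LightTail.integrable_exp_mul_norm (ha : IsKernel a) (h : LightTail a C₁ b p) (hb : 0 < b)
    (hp : 1 ≤ p) {β : ℝ} (hβ : β < b) : Integrable fun x => Real.exp (β * ‖x‖) * a x := by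
  refine ((integrable_exp_neg_mul_norm (d := d) (sub_pos.2 hβ)).const_mul
    (C₁ * Real.exp b)).mono' ((by fun_prop : Continuous fun x : E d =>
      Real.exp (β * ‖x‖)).aestronglyMeasurable.mul ha.integrable.aestronglyMeasurable)
    (ae_of_all _ fun x => ?_)
  rw [Real.norm_of_nonneg (mul_nonneg (Real.exp_pos _).le (ha.nonneg x))]
  refine (mul_le_mul_of_nonneg_left (h.exponential ha hb hp x) (Real.exp_pos _).le).trans
    (le_of_eq ?_)
  rw [mul_left_comm, ← Real.exp_add]
  congr 2
  ring

theorem exp_inner_mul_le (ha : IsKernel a) {γ : E d} {β : ℝ} (hβ : ‖γ‖ ≤ β) (x : E d) :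
    Real.exp (inner ℝ γ x) * a x ≤ Real.exp (β * ‖x‖) * a x :=
  mul_le_mul_of_nonneg_right (Real.exp_le_exp.2 ((real_inner_le_norm γ x).trans
    (mul_le_mul_of_nonneg_right hβ (norm_nonneg x)))) (ha.nonneg x)

theorem mem_expDomain_of_integrable (ha : IsKernel a) {β : ℝ}
    (hi : Integrable fun x => Real.exp (β * ‖x‖) * a x) {γ : E d} (hγ : ‖γ‖ ≤ β) :
    γ ∈ expDomain a := by
  refine hi.mono' (aestronglyMeasurable_exp_mul ha γ) (ae_of_all _ fun x => ?_)
  rw [Real.norm_of_nonneg (mul_nonneg (Real.exp_pos _).le (ha.nonneg x))]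
  exact exp_inner_mul_le ha hγ x

theorem expMean_le_integral (ha : IsKernel a) {β : ℝ}
    (hi : Integrable fun x => Real.exp (β * ‖x‖) * a x) {γ : E d} (hγ : ‖γ‖ ≤ β) :
    expMean a γ ≤ ∫ x, Real.exp (β * ‖x‖) * a x :=
  integral_mono (mem_expDomain_of_integrable ha hi hγ) hi fun x => exp_inner_mul_le ha hγ x

theorem norm_le_of_mem_expDomain (ha : IsKernel a) (hb : 0 < b) (hA1 : CondA1 a b) {γ : E d}
    (hγ : γ ∈ expDomain a) : ‖γ‖ ≤ b := by
  by_contra! hlt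
  have h0 : ‖γ‖ ≠ 0 := (hb.trans hlt).ne'
  have := hA1 ‖γ‖ hlt (‖γ‖⁻¹ • γ) (by rw [norm_smul, norm_inv, norm_norm, inv_mul_cancel₀ h0])
  rw [smul_smul, mul_inv_cancel₀ h0, one_smul] at this
  exact (mem_expDomain_iff ha).1 hγ this

/-- This is the constant in the Chernoff bound, needed even for `γ` on the boundary of the domain.
For `p = 1`, condition `A₁` confines the domain to `‖γ‖ ≤ b`; for `p > 1` the tail is superlinear,
and `b u ^ p` overtakes `‖γ‖ u` at `u = (‖γ‖ / b) ^ (1 / (p - 1))`. -/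
theorem exists_exp_inner_mul_le (ha : IsKernel a) (hb : 0 < b) (hp : 1 ≤ p)
    (hlt : LightTail a C₁ b p) (hA1 : p = 1 → CondA1 a b) {γ : E d} (hγ : γ ∈ expDomain a) :
    ∃ B, ∀ x, Real.exp (inner ℝ γ x) * a x ≤ B := by
  have hC := hlt.nonneg ha
  obtain ⟨R, hR⟩ : ∃ R, ∀ u : ℝ, 0 ≤ u → ‖γ‖ * u - b * u ^ p ≤ R := by
    rcases hp.eq_or_lt with rfl | hp1
    · refine ⟨0, fun u hu => ?_⟩
      have := norm_le_of_mem_expDomain ha hb (hA1 rfl) hγ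
      rw [Real.rpow_one]
      nlinarith
    · refine ⟨‖γ‖ * (‖γ‖ / b) ^ (1 / (p - 1)), fun u hu => ?_⟩
      have hp0 : 0 < p - 1 := sub_pos.2 hp1
      rcases le_total u ((‖γ‖ / b) ^ (1 / (p - 1))) with h | h
      · have h1 := mul_le_mul_of_nonneg_left h (norm_nonneg γ)
        have h2 : 0 ≤ b * u ^ p := mul_nonneg hb.le (Real.rpow_nonneg hu p)
        linarith
      · have h1 : ‖γ‖ / b ≤ u ^ (p - 1) := by
          have := Real.rpow_le_rpow (by positivity) h hp0.le
          rwa [← Real.rpow_mul (by positivity), one_div_mul_cancel hp0.ne', Real.rpow_one] at this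
        rw [div_le_iff₀ hb] at h1
        have h2 : u ^ p = u ^ (p - 1) * u := by
          rcases hu.eq_or_lt with rfl | hu0
          · rw [Real.zero_rpow (by linarith), mul_zero]
          · rw [← Real.rpow_add_one hu0.ne']; congr 1; ring
        have h3 : 0 ≤ ‖γ‖ * (‖γ‖ / b) ^ (1 / (p - 1)) := by positivity
        rw [h2]
        nlinarith
  refine ⟨C₁ * Real.exp R, fun x => ?_⟩
  calc Real.exp (inner ℝ γ x) * a x
      ≤ Real.exp (‖γ‖ * ‖x‖) * (C₁ * Real.exp (-b * ‖x‖ ^ p)) :=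
        mul_le_mul (Real.exp_le_exp.2 (real_inner_le_norm γ x)) (hlt x) (ha.nonneg x)
          (Real.exp_pos _).le
    _ = C₁ * Real.exp (‖γ‖ * ‖x‖ - b * ‖x‖ ^ p) := by
        rw [mul_left_comm, ← Real.exp_add]; congr 2; ring
    _ ≤ _ := mul_le_mul_of_nonneg_left (Real.exp_le_exp.2 (hR _ (norm_nonneg x))) hC

/-! ### Chernoff bound for convolution powers and for the heat kernel -/

theorem convPow_nonneg (ha : IsKernel a) (n : ℕ) (x : E d) : 0 ≤ convPow a n x := by
  induction n generalizing x with
  | zero => exact ha.nonneg x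
  | succ n ih =>
    exact integral_nonneg fun y => mul_nonneg (ih y) (ha.nonneg _)

/-- The Chernoff bound for the density of a sum of independent copies of `X`. -/
theorem convPow_le (ha : IsKernel a) {γ : E d} (hγ : γ ∈ expDomain a) {B : ℝ}
    (hB : ∀ x, Real.exp (inner ℝ γ x) * a x ≤ B) (n : ℕ) (x : E d) :
    convPow a n x ≤ B * expMean a γ ^ n * Real.exp (-inner ℝ γ x) := by
  induction n generalizing x with
  | zero =>
    rw [pow_zero, mul_one, Real.exp_neg, ← div_eq_mul_inv, le_div_iff₀ (Real.exp_pos _), mul_comm]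
    exact hB x
  | succ n ih =>
    have h0 : Integrable fun y => Real.exp (inner ℝ γ y) * a y := hγ
    have h1 : Integrable fun y => Real.exp (inner ℝ γ (x - y)) * a (x - y) := h0.comp_sub_left x
    have h2 : ∀ y, convPow a n y * a (x - y) ≤ (B * expMean a γ ^ n * Real.exp (-inner ℝ γ x)) *
        (Real.exp (inner ℝ γ (x - y)) * a (x - y)) := by
      intro y
      refine (mul_le_mul_of_nonneg_right (ih y) (ha.nonneg _)).trans (le_of_eq ?_)
      rw [show -(inner ℝ γ y : ℝ) = -inner ℝ γ x + inner ℝ γ (x - y) by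
        rw [inner_sub_right]; ring, Real.exp_add]
      ring
    calc convPow a (n + 1) x = ∫ y, convPow a n y * a (x - y) := rfl
      _ ≤ ∫ y, (B * expMean a γ ^ n * Real.exp (-inner ℝ γ x)) *
        (Real.exp (inner ℝ γ (x - y)) * a (x - y)) :=
          integral_mono_of_nonneg (ae_of_all _ fun y =>
            mul_nonneg (convPow_nonneg ha n y) (ha.nonneg _)) (h1.const_mul _) (ae_of_all _ h2)
      _ = _ := by
          rw [integral_const_mul,
            integral_sub_left_eq_self (fun y => Real.exp (inner ℝ γ y) * a y) volume x]
          change _ * expMean a γ = _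
          rw [pow_succ]; ring

theorem abs_heatTerm_le (ha : IsKernel a) {γ : E d} (hγ : γ ∈ expDomain a) {B : ℝ}
    (hB : ∀ x, Real.exp (inner ℝ γ x) * a x ≤ B) (x : E d) (t : ℝ) (n : ℕ) :
    |heatTerm a x t n| ≤ B * Real.exp (-inner ℝ γ x) *
      ((|t| * expMean a γ) ^ (n + 1) / ((n + 1).factorial : ℝ)) := by
  have hM := one_le_expMean ha hγ
  have hB0 : 0 ≤ B := (mul_nonneg (Real.exp_pos _).le (ha.nonneg 0)).trans (hB 0)
  rw [heatTerm, abs_div, abs_mul, abs_pow, abs_of_nonneg (convPow_nonneg ha n x),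
    Nat.abs_cast, mul_div_assoc']
  refine div_le_div_of_nonneg_right ?_ (Nat.cast_nonneg _)
  rw [mul_pow, mul_left_comm]
  refine mul_le_mul_of_nonneg_left ((convPow_le ha hγ hB n x).trans ?_) (by positivity)
  rw [mul_right_comm]
  -- The Chernoff bound has only `n` factors of `Λ`; one more is harmless since `Λ ≥ 1`, and it
  -- matches the exponential series.
  refine mul_le_mul_of_nonneg_left (pow_le_pow_right₀ hM (Nat.le_succ n))
    (mul_nonneg hB0 (Real.exp_pos _).le)

theorem summable_heatTerm (ha : IsKernel a) {γ : E d} (hγ : γ ∈ expDomain a) {B : ℝ}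
    (hB : ∀ x, Real.exp (inner ℝ γ x) * a x ≤ B) (x : E d) (t : ℝ) :
    Summable (heatTerm a x t) :=
  Summable.of_norm_bounded
    ((((Real.summable_pow_div_factorial (|t| * expMean a γ)).comp_injective
      (add_left_injective 1))).mul_left _) fun n => abs_heatTerm_le ha hγ hB x t n

theorem heatKernel_le (ha : IsKernel a) {γ : E d} (hγ : γ ∈ expDomain a) {B : ℝ}
    (hB : ∀ x, Real.exp (inner ℝ γ x) * a x ≤ B) (x : E d) {t : ℝ} (ht : 0 ≤ t) :
    heatKernel a x t ≤ B * Real.exp (-inner ℝ γ x + t * (expMean a γ - 1)) := by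
  have hB0 : 0 ≤ B := (mul_nonneg (Real.exp_pos _).le (ha.nonneg 0)).trans (hB 0)
  have hs := Real.summable_pow_div_factorial (|t| * expMean a γ)
  have hs1 := (summable_nat_add_iff 1).2 hs
  have h1 : ∑' n, heatTerm a x t n ≤ ∑' n : ℕ, B * Real.exp (-inner ℝ γ x) *
      ((|t| * expMean a γ) ^ (n + 1) / ((n + 1).factorial : ℝ)) :=
    (summable_heatTerm ha hγ hB x t).tsum_le_tsum
      (fun n => (le_abs_self _).trans (abs_heatTerm_le ha hγ hB x t n)) (hs1.mul_left _)
  have h2 : ∑' n : ℕ, (|t| * expMean a γ) ^ (n + 1) / ((n + 1).factorial : ℝ) ≤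
      Real.exp (t * expMean a γ) := by
    have h3 := hs.tsum_eq_zero_add
    have h4 : Real.exp (|t| * expMean a γ) =
        ∑' n : ℕ, (|t| * expMean a γ) ^ n / (n.factorial : ℝ) := by
      rw [Real.exp_eq_exp_ℝ, NormedSpace.exp_eq_tsum_div]
    rw [h3, abs_of_nonneg ht] at h4
    rw [abs_of_nonneg ht, h4]
    simp
  rw [tsum_mul_left] at h1
  have h5 := h1.trans (mul_le_mul_of_nonneg_left h2 (mul_nonneg hB0 (Real.exp_pos _).le))
  refine (mul_le_mul_of_nonneg_left h5 (Real.exp_pos (-t)).le).trans (le_of_eq ?_)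
  rw [mul_assoc B, ← Real.exp_add, mul_left_comm, ← Real.exp_add]
  congr 2
  ring

theorem exists_heatKernel_le (ha : IsKernel a) (hb : 0 < b) (hp : 1 ≤ p)
    (hlt : LightTail a C₁ b p) (hA1 : p = 1 → CondA1 a b) {r : E d} (hr : 0 < Phi a r)
    {x : ℝ → E d} (hx : (fun t : ℝ => x t - t • r) =o[atTop] fun t : ℝ => t) :
    ∃ ε : ℝ → ℝ, Tendsto ε atTop (𝓝 0) ∧ ∀ᶠ t : ℝ in atTop,
      heatKernel a (x t) t ≤ Real.exp (-(Phi a r) * t * (1 + ε t)) := by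
  obtain ⟨γ, h⟩ := exists_isExpDual ha r
  obtain ⟨B, hB⟩ := exists_exp_inner_mul_le ha hb hp hlt hA1 h.mem
  have hΦ := Phi_eq ha h
  -- This error absorbs the deviation of `x t` from `t • r` and the prefactor, bounded by `B ≤ exp
  -- |B|`.
  refine ⟨fun t => (inner ℝ γ (x t - t • r) - |B|) / (Phi a r * t), ?_, ?_⟩
  · have h1 : (fun t : ℝ => (inner ℝ γ (x t - t • r) : ℝ) - |B|) =o[atTop] fun t : ℝ => t := by
      refine Asymptotics.IsLittleO.sub ?_ (Asymptotics.isLittleO_const_id_atTop _)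
      refine Asymptotics.IsBigO.trans_isLittleO (Asymptotics.IsBigO.of_bound ‖γ‖
        (Eventually.of_forall fun t => ?_)) hx
      exact norm_inner_le_norm γ _
    have h2 := h1.tendsto_div_nhds_zero.div_const (Phi a r)
    rw [zero_div] at h2
    refine h2.congr fun t => ?_
    rw [div_div, mul_comm t]
  · filter_upwards [eventually_gt_atTop 0] with t ht
    refine (heatKernel_le ha h.mem hB (x t) ht.le).trans ?_
    have h1 : B ≤ Real.exp |B| := (le_abs_self B).trans (by
      have := Real.add_one_le_exp |B|
      linarith)
    refine (mul_le_mul_of_nonneg_right h1 (Real.exp_pos _).le).trans ?_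
    rw [← Real.exp_add, Real.exp_le_exp]
    have h2 : -(Phi a r) * t * (1 + (inner ℝ γ (x t - t • r) - |B|) / (Phi a r * t)) =
        -(Phi a r) * t - (inner ℝ γ (x t - t • r) - |B|) := by
      field_simp
      ring
    rw [h2, hΦ, inner_sub_right, inner_smul_right]
    linarith

/-! ### Growth of `Φ` at infinity: general bound, `p = 1`, bounded support -/

theorem isEquivalent_of_forall_le {α : Type*} {l : Filter α} {f g : α → ℝ}
    (hg : ∀ᶠ x in l, 0 ≤ g x)
    (h : ∀ ε : ℝ, 0 < ε → ∀ᶠ x in l, (1 - ε) * g x ≤ f x ∧ f x ≤ (1 + ε) * g x) :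
    Asymptotics.IsEquivalent l f g := by
  rw [Asymptotics.IsEquivalent, Asymptotics.isLittleO_iff]
  intro ε hε
  filter_upwards [hg, h ε hε] with x h0 ⟨h1, h2⟩
  rw [Pi.sub_apply, Real.norm_of_nonneg h0, Real.norm_eq_abs, abs_le]
  constructor <;> linarith

theorem exists_norm_le_inner_eq (r : E d) {ρ : ℝ} (hρ : 0 ≤ ρ) :
    ∃ γ : E d, ‖γ‖ ≤ ρ ∧ (inner ℝ γ r : ℝ) = ρ * ‖r‖ := by
  by_cases hr : r = 0
  · exact ⟨0, by simpa using hρ, by simp [hr]⟩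
  · have h0 : ‖r‖ ≠ 0 := norm_ne_zero_iff.2 hr
    refine ⟨(ρ / ‖r‖) • r, ?_, ?_⟩
    · rw [norm_smul, Real.norm_of_nonneg (by positivity), div_mul_cancel₀ _ h0]
    · rw [real_inner_smul_left, real_inner_self_eq_norm_sq]
      field_simp

theorem mul_norm_sub_le_Phi (ha : IsKernel a) {β : ℝ} (hβ : 0 ≤ β)
    (hi : Integrable fun x => Real.exp (β * ‖x‖) * a x) (r : E d) :
    β * ‖r‖ - (∫ x, Real.exp (β * ‖x‖) * a x) + 1 ≤ Phi a r := by
  obtain ⟨γ, h1, h2⟩ := exists_norm_le_inner_eq r hβ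
  have h3 := le_Phi ha r (mem_expDomain_of_integrable ha hi h1)
  have h4 := expMean_le_integral ha hi h1
  linarith

theorem tendsto_Phi_cobounded (ha : IsKernel a) (hb : 0 < b) (hp : 1 ≤ p)
    (hlt : LightTail a C₁ b p) : Tendsto (Phi a) (Bornology.cobounded (E d)) atTop := by
  have hi := hlt.integrable_exp_mul_norm ha hb hp (half_lt_self hb)
  refine tendsto_atTop_mono (mul_norm_sub_le_Phi ha (half_pos hb).le hi) ?_
  exact tendsto_atTop_add_const_right _ _ (tendsto_atTop_add_const_right _ _
    (tendsto_norm_cobounded_atTop.const_mul_atTop (half_pos hb)))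

/-- The domain of `Λ` lies in the ball of radius `b`, which caps `γ · r`; trial vectors of length
just below `b` along `r` nearly reach this cap at a cost independent of `r`. -/
theorem isEquivalent_Phi_of_condA1 (ha : IsKernel a) (hb : 0 < b) (hp : 1 ≤ p)
    (hlt : LightTail a C₁ b p) (hA1 : CondA1 a b) :
    Asymptotics.IsEquivalent (Bornology.cobounded (E d)) (Phi a) fun r => b * ‖r‖ := by
  refine isEquivalent_of_forall_le (Eventually.of_forall fun r => by positivity) fun ε hε => ?_
  have hup : ∀ r, Phi a r ≤ (1 + ε) * (b * ‖r‖) := fun r => Phi_le ha fun γ hγ => by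
    have h1 := mul_le_mul_of_nonneg_right (norm_le_of_mem_expDomain ha hb hA1 hγ) (norm_nonneg r)
    have h2 := real_inner_le_norm γ r
    have h3 := one_le_expMean ha hγ
    have h4 : 0 ≤ ε * (b * ‖r‖) := by positivity
    linarith
  rcases le_total 1 ε with h1 | h1
  · refine Eventually.of_forall fun r => ⟨?_, hup r⟩
    exact (mul_nonpos_of_nonpos_of_nonneg (by linarith) (by positivity)).trans (Phi_nonneg ha r)
  · have hβ : (1 - ε / 2) * b < b := by nlinarith
    have hi := hlt.integrable_exp_mul_norm ha hb hp hβ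
    filter_upwards [tendsto_norm_cobounded_atTop.eventually_ge_atTop
      ((∫ x, Real.exp ((1 - ε / 2) * b * ‖x‖) * a x) / (ε / 2 * b))] with r hr
    refine ⟨?_, hup r⟩
    rw [div_le_iff₀ (by positivity)] at hr
    have h2 := mul_norm_sub_le_Phi ha (mul_nonneg (by linarith) hb.le) hi r
    linarith

/-- Dominated convergence, the sphere `‖x‖ = μ` being null. The resulting `o(exp (ρ μ))` bound on
`Λ` is what removes any error term from the final inequality. -/
theorem SuppInBall.tendsto_integral {μ : ℝ} (ha : IsKernel a) (hμ : 0 < μ)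
    (h : SuppInBall a μ) :
    (∀ ρ : ℝ, 0 ≤ ρ → Integrable fun x => Real.exp (ρ * (‖x‖ - μ)) * a x) ∧
    Tendsto (fun ρ : ℝ => ∫ x, Real.exp (ρ * (‖x‖ - μ)) * a x) atTop (𝓝 0) := by
  have hmeas : ∀ ρ : ℝ, AEStronglyMeasurable (fun x => Real.exp (ρ * (‖x‖ - μ)) * a x) volume :=
    fun ρ => (by fun_prop : Continuous fun x : E d =>
      Real.exp (ρ * (‖x‖ - μ))).aestronglyMeasurable.mul ha.integrable.aestronglyMeasurable
  have hbd : ∀ ρ : ℝ, 0 ≤ ρ → ∀ᵐ x, ‖Real.exp (ρ * (‖x‖ - μ)) * a x‖ ≤ a x := by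
    intro ρ hρ
    filter_upwards [h] with x hx
    rw [Real.norm_of_nonneg (mul_nonneg (Real.exp_pos _).le (ha.nonneg x))]
    by_cases hxμ : μ < ‖x‖
    · rw [hx hxμ, mul_zero]
    · refine mul_le_of_le_one_left (ha.nonneg x) (Real.exp_le_one_iff.2 ?_)
      exact mul_nonpos_of_nonneg_of_nonpos hρ (by linarith)
  refine ⟨fun ρ hρ => ha.integrable.mono' (hmeas ρ) (hbd ρ hρ), ?_⟩
  have hlim := tendsto_integral_filter_of_dominated_convergence (μ := (volume : Measure (E d)))
    (l := atTop) (F := fun (ρ : ℝ) x => Real.exp (ρ * (‖x‖ - μ)) * a x) (f := fun _ => (0 : ℝ)) a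
    (Eventually.of_forall hmeas) ((eventually_ge_atTop 0).mono hbd) ha.integrable ?_
  · simpa using hlim
  · have hs : ∀ᵐ x : E d, ‖x‖ ≠ μ := by
      have := Measure.addHaar_sphere_of_ne_zero (volume : Measure (E d)) 0 hμ.ne'
      rw [ae_iff]
      convert this using 2
      ext x
      simp
    filter_upwards [h, hs] with x hx hne
    rcases lt_or_gt_of_ne hne with hlt | hgt
    · have h1 : Tendsto (fun ρ : ℝ => Real.exp (ρ * (‖x‖ - μ))) atTop (𝓝 0) :=
        Real.tendsto_exp_atBot.comp (tendsto_id.atTop_mul_const_of_neg (by linarith))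
      simpa using h1.mul_const (a x)
    · simp [hx hgt]

theorem SuppInBall.eventually_le_Phi {μ : ℝ} (ha : IsKernel a) (hμ : 0 < μ)
    (h : SuppInBall a μ) : ∀ᶠ r in Bornology.cobounded (E d),
      1 / μ * ‖r‖ * Real.log ‖r‖ ≤ Phi a r := by
  obtain ⟨hint, hlim⟩ := h.tendsto_integral ha hμ
  have hρ : Tendsto (fun r : E d => (Real.log ‖r‖ + 1) / μ) (Bornology.cobounded (E d)) atTop :=
    (tendsto_atTop_add_const_right _ _
      (Real.tendsto_log_atTop.comp tendsto_norm_cobounded_atTop)).atTop_div_const hμ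
  have hsmall := (hlim.comp hρ).eventually (gt_mem_nhds
    (show 0 < 1 / μ / Real.exp 1 by positivity))
  filter_upwards [hsmall, hρ.eventually_ge_atTop 0,
    tendsto_norm_cobounded_atTop.eventually_gt_atTop 0] with r h1 h2 h3
  simp only [Function.comp_apply] at h1
  -- The extra `1` gains `‖r‖ / μ` in the linear term. It pays for `Λ`, which is at most `exp (ρ μ)
  -- = e ‖r‖` times an integral below `1 / (μ e)`.
  set ρ := (Real.log ‖r‖ + 1) / μ with hρdef
  have hρμ : ρ * μ = Real.log ‖r‖ + 1 := by rw [hρdef]; field_simp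
  have e : (fun x => Real.exp (ρ * ‖x‖) * a x) =
      fun x => Real.exp (ρ * μ) * (Real.exp (ρ * (‖x‖ - μ)) * a x) := by
    funext x
    rw [← mul_assoc, ← Real.exp_add]
    congr 2
    ring
  have hi : Integrable fun x => Real.exp (ρ * ‖x‖) * a x := by
    rw [e]
    exact (hint ρ h2).const_mul _
  have h4 := mul_norm_sub_le_Phi ha h2 hi r
  rw [e, integral_const_mul, hρμ, Real.exp_add, Real.exp_log h3] at h4
  rw [lt_div_iff₀ (Real.exp_pos 1)] at h1
  have h5 := mul_le_mul_of_nonneg_left h1.le h3.le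
  have h6 : ρ * ‖r‖ = 1 / μ * ‖r‖ * Real.log ‖r‖ + ‖r‖ * (1 / μ) := by
    rw [hρdef]; field_simp
  linarith

/-! ### Behaviour of `Φ` near zero, and positivity -/

theorem cosh_le_one_add (u : ℝ) :
    Real.cosh u ≤ 1 + u ^ 2 / 2 + |u| ^ 3 * Real.exp |u| := by
  have h : ∀ v : ℝ, Real.exp v ≤ 1 + v + v ^ 2 / 2 + |v| ^ 3 * Real.exp |v| := by
    intro v
    have := Complex.norm_exp_sub_sum_le_norm_mul_exp (v : ℂ) 3
    rw [Finset.sum_range_succ, Finset.sum_range_succ, Finset.sum_range_one] at this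
    norm_num at this
    norm_cast at this
    have := (le_abs_self _).trans this
    linarith
  have h1 := h u
  have h2 := h (-u)
  rw [abs_neg, neg_sq] at h2
  rw [Real.cosh_eq]
  linarith

theorem LightTail.exists_expMean_le (ha : IsKernel a) (hb : 0 < b) (hp : 1 ≤ p)
    (hlt : LightTail a C₁ b p) : ∃ C, 0 ≤ C ∧ ∀ γ : E d, ‖γ‖ ≤ b / 2 → γ ∈ expDomain a ∧
      expMean a γ ≤ 1 + secondMoment a γ / 2 + C * ‖γ‖ ^ 3 := by
  -- The rate `3b/4` splits as `b/2` for `exp |γ · x|` and `b/4` to absorb the cubic factor `‖x‖ ^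
  -- 3`.
  have hi := hlt.integrable_exp_mul_norm ha hb hp (show 3 / 4 * b < b by linarith)
  set K : ℝ := 6 / (b / 4) ^ 3 with hK
  have hK0 : 0 ≤ K := by positivity
  refine ⟨K * ∫ x, Real.exp (3 / 4 * b * ‖x‖) * a x, mul_nonneg hK0 (integral_nonneg fun x =>
    mul_nonneg (Real.exp_pos _).le (ha.nonneg x)), fun γ hγ => ?_⟩
  have hmem := mem_expDomain_of_integrable ha hi (hγ.trans (by linarith))
  refine ⟨hmem, ?_⟩
  obtain ⟨hc, he⟩ := expMean_eq_integral_cosh ha hmem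
  have hq := integrable_inner_sq_mul ha γ
  rw [he]
  have hbound : ∀ x : E d, Real.cosh (inner ℝ γ x) ≤ 1 + 1 / 2 * (inner ℝ γ x : ℝ) ^ 2 +
      ‖γ‖ ^ 3 * K * Real.exp (3 / 4 * b * ‖x‖) := by
    intro x
    refine (cosh_le_one_add _).trans ?_
    have h1 := abs_real_inner_le_norm γ x
    have h2 : |(inner ℝ γ x : ℝ)| ^ 3 ≤ ‖γ‖ ^ 3 * ‖x‖ ^ 3 := by
      rw [← mul_pow]
      exact pow_le_pow_left₀ (abs_nonneg _) h1 3
    have h3 : Real.exp |(inner ℝ γ x : ℝ)| ≤ Real.exp (b / 2 * ‖x‖) :=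
      Real.exp_le_exp.2 (h1.trans (mul_le_mul_of_nonneg_right hγ (norm_nonneg x)))
    have h4 : ‖x‖ ^ 3 ≤ K * Real.exp (b / 4 * ‖x‖) := by
      have := Real.pow_div_factorial_le_exp (b / 4 * ‖x‖) (by positivity) 3
      rw [div_le_iff₀ (by positivity), mul_pow] at this
      rw [hK, div_mul_eq_mul_div, le_div_iff₀ (by positivity)]
      norm_num [Nat.factorial] at this
      linarith
    have h5 : |(inner ℝ γ x : ℝ)| ^ 3 * Real.exp |(inner ℝ γ x : ℝ)| ≤
        (‖γ‖ ^ 3 * (K * Real.exp (b / 4 * ‖x‖))) * Real.exp (b / 2 * ‖x‖) :=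
      mul_le_mul (h2.trans (mul_le_mul_of_nonneg_left h4 (by positivity))) h3 (Real.exp_pos _).le
        (by positivity)
    have h6 : Real.exp (3 / 4 * b * ‖x‖) =
        Real.exp (b / 4 * ‖x‖) * Real.exp (b / 2 * ‖x‖) := by
      rw [← Real.exp_add]; congr 1; ring
    rw [h6]
    linarith
  have hadd : Integrable fun x => a x + 1 / 2 * ((inner ℝ γ x : ℝ) ^ 2 * a x) :=
    ha.integrable.add (hq.const_mul _)
  calc ∫ x, Real.cosh (inner ℝ γ x) * a x
      ≤ ∫ x, (a x + 1 / 2 * ((inner ℝ γ x : ℝ) ^ 2 * a x) +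
        ‖γ‖ ^ 3 * K * (Real.exp (3 / 4 * b * ‖x‖) * a x)) := by
        refine integral_mono hc (hadd.add (hi.const_mul _))
          fun x => ?_
        have := mul_le_mul_of_nonneg_right (hbound x) (ha.nonneg x)
        simp only
        linarith
    _ = _ := by
        rw [integral_add hadd (hi.const_mul _),
          integral_add ha.integrable (hq.const_mul _), integral_const_mul, integral_const_mul,
          ha.integral_eq_one, secondMoment]
        ring

theorem exists_secondMoment_le (ha : IsKernel a) :
    ∃ S, 0 ≤ S ∧ ∀ γ : E d, secondMoment a γ ≤ S * ‖γ‖ ^ 2 := by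
  refine ⟨∫ x, ‖x‖ ^ 2 * a x, integral_nonneg fun x => mul_nonneg (by positivity) (ha.nonneg x),
    fun γ => ?_⟩
  rw [mul_comm, ← integral_const_mul]
  refine integral_mono (integrable_inner_sq_mul ha γ) (ha.second_moment.const_mul _) fun x => ?_
  simp only
  rw [← mul_assoc, ← mul_pow, ← sq_abs (inner ℝ γ x : ℝ)]
  exact mul_le_mul_of_nonneg_right (pow_le_pow_left₀ (abs_nonneg _)
    (abs_real_inner_le_norm γ x) 2) (ha.nonneg x)

/-- For a short trial vector along `r`, the linear gain `ρ ‖r‖` beats the cost `Λ - 1`, which is of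
order `ρ ^ 2`. -/
theorem Phi_pos (ha : IsKernel a) (hb : 0 < b) (hp : 1 ≤ p) (hlt : LightTail a C₁ b p) {r : E d}
    (hr : r ≠ 0) : 0 < Phi a r := by
  obtain ⟨C, hC, H⟩ := hlt.exists_expMean_le ha hb hp
  obtain ⟨S, hS0, hS⟩ := exists_secondMoment_le ha
  have hn : 0 < ‖r‖ := norm_pos_iff.2 hr
  obtain ⟨ρ, hρ0, hρ1, hρ2⟩ : ∃ ρ : ℝ, 0 < ρ ∧ ρ ≤ b / 2 ∧ ρ * (S + C * b + 1) ≤ ‖r‖ := by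
    have hD : 0 < S + C * b + 1 := by positivity
    exact ⟨min (b / 2) (‖r‖ / (S + C * b + 1)), lt_min (half_pos hb) (by positivity),
      min_le_left _ _, by
        rw [← le_div_iff₀ hD]; exact min_le_right _ _⟩
  obtain ⟨γ, h1, h2⟩ := exists_norm_le_inner_eq r hρ0.le
  obtain ⟨h3, h4⟩ := H γ (h1.trans hρ1)
  have h5 := le_Phi ha r h3
  have h6 := hS γ
  have h7 : ‖γ‖ ^ 2 ≤ ρ ^ 2 := pow_le_pow_left₀ (norm_nonneg _) h1 2
  have h8 : C * ‖γ‖ ^ 3 ≤ C * (b / 2 * ρ ^ 2) := by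
    refine mul_le_mul_of_nonneg_left ?_ hC
    rw [pow_succ, mul_comm]
    exact mul_le_mul (h1.trans hρ1) h7 (by positivity) (by positivity)
  have h9 : S * ‖γ‖ ^ 2 ≤ S * ρ ^ 2 := mul_le_mul_of_nonneg_left h7 hS0
  have h10 := mul_le_mul_of_nonneg_left hρ2 hρ0.le
  have h11 : 0 < ρ ^ 2 := by positivity
  have h12 : 0 ≤ S * ρ ^ 2 := by positivity
  have h13 : 0 ≤ C * (b * ρ ^ 2) := by positivity
  nlinarith

theorem integrable_coord_mul (ha : IsKernel a) (i j : Fin d) :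
    Integrable fun x : E d => x i * x j * a x := by
  refine ha.second_moment.mono' ((by fun_prop : Continuous fun x : E d =>
    x i * x j).aestronglyMeasurable.mul ha.integrable.aestronglyMeasurable)
    (ae_of_all _ fun x => ?_)
  rw [norm_mul, norm_mul, Real.norm_of_nonneg (ha.nonneg x), sq]
  exact mul_le_mul_of_nonneg_right (mul_le_mul (PiLp.norm_apply_le x i) (PiLp.norm_apply_le x j)
    (norm_nonneg _) (norm_nonneg _)) (ha.nonneg x)

theorem integral_inner_mul_inner (ha : IsKernel a) (γ η : E d) :
    Integrable (fun x => (inner ℝ γ x : ℝ) * inner ℝ η x * a x) ∧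
      ∫ x, (inner ℝ γ x : ℝ) * inner ℝ η x * a x =
        (fun i => γ i) ⬝ᵥ (covMatrix a).mulVec (fun i => η i) := by
  have e : (fun x => (inner ℝ γ x : ℝ) * inner ℝ η x * a x) =
      fun x => ∑ i, ∑ j, γ i * η j * (x i * x j * a x) := by
    funext x
    simp only [PiLp.inner_apply, RCLike.inner_apply, RCLike.conj_to_real]
    rw [Finset.sum_mul_sum, Finset.sum_mul]
    refine Finset.sum_congr rfl fun i _ => ?_
    rw [Finset.sum_mul]
    exact Finset.sum_congr rfl fun j _ => by ring
  have hi : ∀ i j : Fin d, Integrable fun x : E d => γ i * η j * (x i * x j * a x) :=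
    fun i j => (integrable_coord_mul ha i j).const_mul _
  rw [e]
  refine ⟨integrable_finsetSum _ fun i _ => integrable_finsetSum _ fun j _ => hi i j, ?_⟩
  rw [integral_finsetSum _ fun i _ => integrable_finsetSum _ fun j _ => hi i j]
  simp only [dotProduct, Matrix.mulVec, Finset.mul_sum]
  refine Finset.sum_congr rfl fun i _ => ?_
  rw [integral_finsetSum _ fun j _ => hi i j]
  refine Finset.sum_congr rfl fun j _ => ?_
  rw [integral_const_mul, covMatrix, Matrix.of_apply]
  ring

theorem secondMoment_eq (ha : IsKernel a) (γ : E d) :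
    secondMoment a γ = (fun i => γ i) ⬝ᵥ (covMatrix a).mulVec (fun i => γ i) := by
  rw [← (integral_inner_mul_inner ha γ γ).2]
  simp only [secondMoment, sq]

theorem isUnit_covMatrix (ha : IsKernel a) : IsUnit (covMatrix a) := by
  rw [← Matrix.mulVec_injective_iff_isUnit]
  refine (injective_iff_map_eq_zero (covMatrix a).mulVecLin).2 fun v hv => ?_
  rw [Matrix.mulVecLin_apply] at hv
  by_contra hne
  have h1 : WithLp.toLp 2 v ≠ (0 : E d) := by simpa using hne
  have h2 := secondMoment_pos ha h1
  rw [secondMoment_eq ha] at h2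
  simp [hv] at h2

/-- The vector `σ⁻¹ r`. -/
noncomputable def covInv (a : E d → ℝ) (r : E d) : E d :=
  WithLp.toLp 2 ((covMatrix a)⁻¹.mulVec fun i => r i)

theorem covMatrix_mulVec_covInv (ha : IsKernel a) (r : E d) :
    (covMatrix a).mulVec (fun i => covInv a r i) = fun i => r i := by
  have h := (Matrix.isUnit_iff_isUnit_det _).1 (isUnit_covMatrix ha)
  simp only [covInv]
  rw [Matrix.mulVec_mulVec, Matrix.mul_nonsing_inv _ h, Matrix.one_mulVec]

theorem inner_eq_dotProduct (γ r : E d) : (inner ℝ γ r : ℝ) = (fun i => γ i) ⬝ᵥ fun i => r i := by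
  simp only [PiLp.inner_apply, RCLike.inner_apply, RCLike.conj_to_real, dotProduct, mul_comm]

theorem integral_inner_mul_inner_covInv (ha : IsKernel a) (γ r : E d) :
    ∫ x, (inner ℝ γ x : ℝ) * inner ℝ (covInv a r) x * a x = inner ℝ γ r := by
  rw [(integral_inner_mul_inner ha _ _).2, covMatrix_mulVec_covInv ha, inner_eq_dotProduct]

theorem secondMoment_covInv (ha : IsKernel a) (r : E d) :
    secondMoment a (covInv a r) = inner ℝ (covInv a r) r := by
  rw [← integral_inner_mul_inner_covInv ha]
  simp only [secondMoment, sq]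

/-- Completing the square: the second moment of `γ - σ⁻¹ r` is nonnegative. -/
theorem two_mul_inner_le (ha : IsKernel a) (γ r : E d) :
    2 * (inner ℝ γ r : ℝ) ≤ secondMoment a γ + inner ℝ (covInv a r) r := by
  have h := secondMoment_nonneg ha (γ - covInv a r)
  have hc := (integral_inner_mul_inner ha γ (covInv a r)).1.const_mul 2
  have h1 := integrable_inner_sq_mul ha γ
  have h2 := integrable_inner_sq_mul ha (covInv a r)
  have h12 : Integrable fun x => (inner ℝ γ x : ℝ) ^ 2 * a x +
      (inner ℝ (covInv a r) x : ℝ) ^ 2 * a x := h1.add h2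
  have e : secondMoment a (γ - covInv a r) = secondMoment a γ + secondMoment a (covInv a r) -
      2 * inner ℝ γ r := by
    rw [← integral_inner_mul_inner_covInv ha γ r, ← integral_const_mul, secondMoment, secondMoment,
      secondMoment, ← integral_add h1 h2, ← integral_sub h12 hc]
    refine integral_congr_ae (ae_of_all _ fun x => ?_)
    simp only [inner_sub_left]
    ring
  rw [e, secondMoment_covInv ha] at h
  linarith

/-- The upper bound by the quadratic form holds for every `r`, by completing the square. The lower
one uses the trial vector `σ⁻¹ r`, with a cubic error. -/
theorem isEquivalent_Phi_zero (ha : IsKernel a) (hb : 0 < b) (hp : 1 ≤ p)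
    (hlt : LightTail a C₁ b p) :
    Asymptotics.IsEquivalent (𝓝 0) (Phi a) fun r : E d =>
      1 / 2 * (((covMatrix a)⁻¹.mulVec (fun i => r i)) ⬝ᵥ (fun i => r i)) := by
  have hw : ∀ r : E d, ((covMatrix a)⁻¹.mulVec (fun i => r i)) ⬝ᵥ (fun i => r i) =
      (inner ℝ (covInv a r) r : ℝ) := fun r =>
    (inner_eq_dotProduct (covInv a r) r).symm
  simp only [hw]
  obtain ⟨κ, hκ, hκle⟩ := exists_le_secondMoment ha
  obtain ⟨S, hS0, hS⟩ := exists_secondMoment_le ha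
  obtain ⟨C, hC, H⟩ := hlt.exists_expMean_le ha hb hp
  have hq : ∀ r : E d, 1 / (S + 1) * ‖r‖ ^ 2 ≤ inner ℝ (covInv a r) r := by
    intro r
    have h1 := two_mul_inner_le ha ((1 / (S + 1)) • r) r
    rw [real_inner_smul_left, real_inner_self_eq_norm_sq, secondMoment_smul] at h1
    have h2 : (1 / (S + 1)) ^ 2 * secondMoment a r ≤ 1 / (S + 1) * ‖r‖ ^ 2 := by
      have h3 : secondMoment a r ≤ (S + 1) * ‖r‖ ^ 2 :=
        (hS r).trans (mul_le_mul_of_nonneg_right (by linarith) (by positivity))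
      refine (mul_le_mul_of_nonneg_left h3 (by positivity)).trans (le_of_eq ?_)
      field_simp
    linarith
  have hwn : ∀ r : E d, ‖covInv a r‖ ≤ ‖r‖ / κ := by
    intro r
    have h1 := hκle (covInv a r)
    rw [secondMoment_covInv ha] at h1
    have h2 := real_inner_le_norm (covInv a r) r
    rw [le_div_iff₀ hκ]
    rcases (norm_nonneg (covInv a r)).eq_or_lt with h0 | h0
    · rw [← h0, zero_mul]; exact norm_nonneg r
    · refine le_of_mul_le_mul_left ?_ h0
      linarith
  refine isEquivalent_of_forall_le (Eventually.of_forall fun r => ?_) fun ε hε => ?_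
  · have : 0 ≤ 1 / (S + 1) * ‖r‖ ^ 2 := by positivity
    linarith [hq r]
  -- The first radius keeps `σ⁻¹ r` within `b / 2`; the second makes the cubic error at most `ε / 2`
  -- times the quadratic form.
  have hρ : 0 < min (κ * (b / 2)) (ε / 2 * (1 / (S + 1)) / ((C + 1) / κ ^ 3)) :=
    lt_min (by positivity) (by positivity)
  filter_upwards [Metric.ball_mem_nhds (0 : E d) hρ] with r hr
  rw [mem_ball_zero_iff, lt_min_iff, lt_div_iff₀ (by positivity)] at hr
  obtain ⟨hr1, hr2⟩ := hr
  have hqr := hq r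
  have hq0 : 0 ≤ (inner ℝ (covInv a r) r : ℝ) :=
    (show 0 ≤ 1 / (S + 1) * ‖r‖ ^ 2 by positivity).trans hqr
  constructor
  · have h1 : ‖covInv a r‖ ≤ b / 2 := (hwn r).trans (by rw [div_le_iff₀ hκ]; linarith)
    obtain ⟨h2, h3⟩ := H _ h1
    have h4 := le_Phi ha r h2
    rw [secondMoment_covInv ha] at h3
    have h5 : C * ‖covInv a r‖ ^ 3 ≤ (C + 1) / κ ^ 3 * ‖r‖ * ‖r‖ ^ 2 := by
      have h6 := pow_le_pow_left₀ (norm_nonneg _) (hwn r) 3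
      calc C * ‖covInv a r‖ ^ 3 ≤ (C + 1) * (‖r‖ / κ) ^ 3 :=
            mul_le_mul (by linarith) h6 (by positivity) (by linarith)
        _ = _ := by rw [div_pow]; ring
    have h7 : (C + 1) / κ ^ 3 * ‖r‖ * ‖r‖ ^ 2 ≤ ε / 2 * (1 / (S + 1)) * ‖r‖ ^ 2 :=
      mul_le_mul_of_nonneg_right (by linarith) (by positivity)
    have h8 := mul_le_mul_of_nonneg_left hqr (half_pos hε).le
    linarith
  · refine Phi_le ha fun γ hγ => ?_
    have h1 := one_add_half_secondMoment_le ha hγ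
    have h2 := two_mul_inner_le ha γ r
    have h3 := mul_nonneg hε.le hq0
    linarith

/-! ### Growth of `Φ` under condition `A_p` -/

/-- Condition `A_p` in terms of `logMean`. -/
theorem CondAp.eventually_logMean (ha : IsKernel a) (h : CondAp a b p) {c : ℝ} (hc : 0 < c)
    (hceq : c = (p - 1) / p * (b * p) ^ (-1 / (p - 1))) {δ : ℝ} (hδ : 0 < δ) :
    (∀ γ, γ ∈ expDomain a) ∧ ∃ R : ℝ, ∀ γ : E d, R ≤ ‖γ‖ →
      (1 - δ) * (c * ‖γ‖ ^ (p / (p - 1))) ≤ logMean a γ ∧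
        logMean a γ ≤ (1 + δ) * (c * ‖γ‖ ^ (p / (p - 1))) := by
  have hD : ∀ γ, γ ∈ expDomain a := fun γ => by
    by_contra hγ
    exact h.1 γ (cumulant_of_notMem ha hγ)
  refine ⟨hD, ?_⟩
  have h2 := h.2
  rw [← hceq, Asymptotics.IsEquivalent, Asymptotics.isLittleO_iff] at h2
  have h3 := h2 hδ
  rw [← comap_norm_atTop, eventually_comap, eventually_atTop] at h3
  obtain ⟨R, hR⟩ := h3
  refine ⟨R, fun γ hγ => ?_⟩
  have h4 := hR ‖γ‖ hγ γ rfl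
  have h5 : 0 ≤ c * ‖γ‖ ^ (p / (p - 1)) := by positivity
  rw [Pi.sub_apply, cumulant_of_mem ha (hD γ), EReal.toReal_coe, Real.norm_of_nonneg h5,
    Real.norm_eq_abs, abs_le] at h4
  constructor <;> linarith [h4.1, h4.2]

theorem condAp_constant (hb : 0 < b) (hp : 1 < p) {u : ℝ} (hu : 0 ≤ u) :
    p / (p - 1) * (b * (p - 1)) ^ (1 / p) * u ^ ((p - 1) / p) =
      (u / ((p - 1) / p * (b * p) ^ (-1 / (p - 1)))) ^ ((p - 1) / p) := by
  have hp0 : 0 < p := by linarith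
  have hp1 : 0 < p - 1 := sub_pos.2 hp
  have e1 : (b * (p - 1)) ^ (1 / p) = (b * p) ^ (1 / p) * ((p - 1) / p) ^ (1 / p) := by
    rw [← Real.mul_rpow (by positivity) (by positivity)]
    congr 1
    field_simp
  have e2 : ((p - 1) / p * (b * p) ^ (-1 / (p - 1))) ^ ((p - 1) / p) =
      ((p - 1) / p) ^ ((p - 1) / p) * ((b * p) ^ (1 / p))⁻¹ := by
    rw [Real.mul_rpow (by positivity) (by positivity), ← Real.rpow_mul (by positivity),
      show -1 / (p - 1) * ((p - 1) / p) = -(1 / p) by field_simp, Real.rpow_neg (by positivity)]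
  have h1 : ((p - 1) / p) ^ ((p - 1) / p) * ((p - 1) / p) ^ (1 / p) = (p - 1) / p := by
    rw [← Real.rpow_add (by positivity), show (p - 1) / p + 1 / p = 1 by field_simp; ring,
      Real.rpow_one]
  have h2 : 0 < ((p - 1) / p) ^ ((p - 1) / p) := by positivity
  have h3 : 0 < (b * p) ^ (1 / p) := by positivity
  rw [Real.div_rpow hu (by positivity), e1, e2, eq_div_iff (by positivity)]
  calc _ = p / (p - 1) * (((p - 1) / p) ^ ((p - 1) / p) * ((p - 1) / p) ^ (1 / p)) *
        ((b * p) ^ (1 / p) * ((b * p) ^ (1 / p))⁻¹) * u ^ ((p - 1) / p) := by ring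
    _ = _ := by
      rw [h1, mul_inv_cancel₀ h3.ne']
      field_simp

/-- Let `c ρ₀ ^ q = ln ‖r‖`, the length at which `Λ` reaches the order of `‖r‖` on the logarithmic
scale. Slightly below it, `Λ ≤ ‖r‖` is negligible against `ρ₀ ‖r‖`; slightly above it, `Λ` already
exceeds `‖γ‖ ‖r‖`. Hence `Φ(r) ~ ρ₀ ‖r‖`. -/
theorem isEquivalent_Phi_of_condAp (ha : IsKernel a) (hb : 0 < b) (hp : 1 < p)
    (hAp : CondAp a b p) :
    Asymptotics.IsEquivalent (Bornology.cobounded (E d)) (Phi a)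
      (fun r => p / (p - 1) * (b * (p - 1)) ^ (1 / p) * ‖r‖ *
        (Real.log ‖r‖) ^ ((p - 1) / p)) := by
  have hp0 : 0 < p := by linarith
  have hp1 : 0 < p - 1 := sub_pos.2 hp
  obtain ⟨c, hc⟩ : ∃ c, c = (p - 1) / p * (b * p) ^ (-1 / (p - 1)) := ⟨_, rfl⟩
  have hc0 : 0 < c := by rw [hc]; positivity
  obtain ⟨q, hq⟩ : ∃ q, q = p / (p - 1) := ⟨_, rfl⟩
  have hq1 : 1 ≤ q := by rw [hq, le_div_iff₀ hp1]; linarith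
  have hq0 : 0 < q := one_pos.trans_le hq1
  have hqinv : (p - 1) / p = 1 / q := by rw [hq, one_div_div]
  have hDR := fun δ hδ => hAp.eventually_logMean ha hc0 hc (δ := δ) hδ
  rw [← hq] at hDR
  obtain ⟨ρ₀, hρ₀⟩ : ∃ ρ₀ : E d → ℝ, ∀ r, ρ₀ r = (Real.log ‖r‖ / c) ^ (1 / q) :=
    ⟨_, fun r => rfl⟩
  have hlog : Tendsto (fun r : E d => Real.log ‖r‖) (Bornology.cobounded (E d)) atTop :=
    Real.tendsto_log_atTop.comp tendsto_norm_cobounded_atTop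
  have hρlim : Tendsto ρ₀ (Bornology.cobounded (E d)) atTop := by
    have := (tendsto_rpow_atTop (y := 1 / q) (by positivity)).comp (hlog.atTop_div_const hc0)
    exact this.congr fun r => (hρ₀ r).symm
  have htarget : (fun r : E d => ρ₀ r * ‖r‖) =ᶠ[Bornology.cobounded (E d)]
      (fun r => p / (p - 1) * (b * (p - 1)) ^ (1 / p) * ‖r‖ *
        (Real.log ‖r‖) ^ ((p - 1) / p)) := by
    filter_upwards [hlog.eventually_ge_atTop 0] with r hr
    rw [hρ₀, mul_right_comm, condAp_constant hb hp hr, ← hc, hqinv]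
  refine Asymptotics.IsEquivalent.congr_right ?_ htarget
  have hpow : ∀ r : E d, 0 ≤ Real.log ‖r‖ → c * ρ₀ r ^ q = Real.log ‖r‖ := by
    intro r hr
    rw [hρ₀, ← Real.rpow_mul (by positivity), one_div_mul_cancel hq0.ne', Real.rpow_one]
    field_simp
  refine isEquivalent_of_forall_le
    ((hρlim.eventually_ge_atTop 0).mono fun r hr => mul_nonneg hr (norm_nonneg r)) fun ε hε => ?_
  have hlower : ∀ᶠ r in Bornology.cobounded (E d), (1 - ε) * (ρ₀ r * ‖r‖) ≤ Phi a r := by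
    -- One `η` shortens the trial vector, the other covers `Λ ≤ ‖r‖ ≤ η ρ₀ ‖r‖`.
    obtain ⟨η, hη0, hηε, hη1⟩ : ∃ η : ℝ, 0 < η ∧ 2 * η ≤ ε ∧ η < 1 :=
      ⟨min (ε / 2) (1 / 2), lt_min (by linarith) (by norm_num),
        by linarith [min_le_left (ε / 2) (1 / 2)], by linarith [min_le_right (ε / 2) (1 / 2)]⟩
    have hη1' : 0 < 1 - η := by linarith
    obtain ⟨hD, R, hR⟩ := hDR η hη0
    filter_upwards [hρlim.eventually_ge_atTop (max (R / (1 - η)) (1 / η)),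
      hlog.eventually_ge_atTop 0, tendsto_norm_cobounded_atTop.eventually_gt_atTop 0]
      with r h1 h2 h3
    have h4 : R ≤ (1 - η) * ρ₀ r := by
      have := (le_max_left _ _).trans h1
      rw [div_le_iff₀ hη1'] at this
      linarith
    have h5 : 1 ≤ η * ρ₀ r := by
      have := (le_max_right _ _).trans h1
      rw [div_le_iff₀ hη0] at this
      linarith
    have h0 : 0 < ρ₀ r := pos_of_mul_pos_right (by linarith) hη0.le
    set γ : E d := ((1 - η) * ρ₀ r / ‖r‖) • r with hγ
    have hγn : ‖γ‖ = (1 - η) * ρ₀ r := by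
      rw [hγ, norm_smul, Real.norm_of_nonneg (by positivity), div_mul_cancel₀ _ h3.ne']
    have hγi : (inner ℝ γ r : ℝ) = (1 - η) * ρ₀ r * ‖r‖ := by
      rw [hγ, real_inner_smul_left, real_inner_self_eq_norm_sq]
      field_simp
    have h6 := (hR γ (by rw [hγn]; exact h4)).2
    have h7 : logMean a γ ≤ Real.log ‖r‖ := by
      refine h6.trans ?_
      rw [hγn, Real.mul_rpow hη1'.le h0.le, mul_left_comm c, hpow r h2, ← mul_assoc]
      refine mul_le_of_le_one_left h2 ?_
      have h8 : (1 - η) ^ q ≤ 1 - η := by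
        simpa using Real.rpow_le_rpow_of_exponent_ge hη1' (by linarith) hq1
      have h9 := mul_le_mul_of_nonneg_left h8 (show 0 ≤ 1 + η by linarith)
      nlinarith
    have h8 : expMean a γ ≤ ‖r‖ := by
      rw [← exp_logMean ha (hD γ), ← Real.le_log_iff_exp_le h3]
      exact h7
    have h9 := le_Phi ha r (hD γ)
    rw [hγi] at h9
    have h10 := mul_le_mul_of_nonneg_right h5 h3.le
    have h11 := mul_le_mul_of_nonneg_right hηε (mul_nonneg h0.le h3.le)
    linarith
  have hupper : ∀ᶠ r in Bornology.cobounded (E d), Phi a r ≤ (1 + ε) * (ρ₀ r * ‖r‖) := by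
    -- Chosen so that `(1 + ε) (1 - 2 δ) = 1`: one `δ` is lost in condition `A_p`, the other to `ln
    -- ‖γ‖`.
    obtain ⟨δ, hδ⟩ : ∃ δ, δ = ε / (2 * (1 + ε)) := ⟨_, rfl⟩
    have hδ0 : 0 < δ := by rw [hδ]; positivity
    obtain ⟨hD, R, hR⟩ := hDR δ hδ0
    have hδε : 1 / (1 + ε) = 1 - 2 * δ := by rw [hδ]; field_simp; ring
    have hlogle : ∀ᶠ ρ : ℝ in atTop, Real.log ρ ≤ c * δ * ρ := by
      filter_upwards [Real.isLittleO_log_id_atTop.bound (show 0 < c * δ by positivity),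
        eventually_ge_atTop 0] with ρ h1 h2
      rw [id, Real.norm_of_nonneg h2] at h1
      exact (le_abs_self _).trans h1
    obtain ⟨N, hN⟩ := eventually_atTop.1 hlogle
    filter_upwards [hρlim.eventually_ge_atTop (max (max R N) 1),
      hlog.eventually_ge_atTop 0, tendsto_norm_cobounded_atTop.eventually_ge_atTop 1]
      with r h1 h2 h3
    simp only [max_le_iff] at h1
    obtain ⟨⟨hR1, hN1⟩, hone⟩ := h1
    have h0 : 0 < ρ₀ r := by linarith
    refine Phi_le ha fun γ hγ => ?_
    have h4 := real_inner_le_norm γ r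
    rcases le_total ‖γ‖ ((1 + ε) * ρ₀ r) with h5 | h5
    · have h6 := mul_le_mul_of_nonneg_right h5 (norm_nonneg r)
      have h7 := one_le_expMean ha hγ
      linarith
    · have hγρ : ρ₀ r ≤ ‖γ‖ := le_trans (by nlinarith) h5
      have hγ1 : 1 ≤ ‖γ‖ := hone.trans hγρ
      have h6 := (hR γ (hR1.trans hγρ)).1
      have h7 : Real.log ‖γ‖ ≤ c * δ * ‖γ‖ ^ q :=
        (hN _ (hN1.trans hγρ)).trans (mul_le_mul_of_nonneg_left
          (Real.self_le_rpow_of_one_le hγ1 hq1) (by positivity))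
      have h8 : Real.log ‖r‖ ≤ (1 - 2 * δ) * (c * ‖γ‖ ^ q) := by
        rw [← hδε, ← hpow r h2]
        have h9 : (1 + ε) * ρ₀ r ^ q ≤ ‖γ‖ ^ q := by
          refine le_trans ?_ (Real.rpow_le_rpow (by positivity) h5 hq0.le)
          rw [Real.mul_rpow (by positivity) h0.le]
          exact mul_le_mul_of_nonneg_right
            (Real.self_le_rpow_of_one_le (by linarith) hq1) (by positivity)
        rw [div_mul_eq_mul_div, one_mul, le_div_iff₀ (by positivity)]
        have := mul_le_mul_of_nonneg_left h9 hc0.le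
        linarith
      have h9 : ‖γ‖ * ‖r‖ ≤ expMean a γ := by
        rw [← exp_logMean ha hγ, ← Real.exp_log (show 0 < ‖γ‖ * ‖r‖ by positivity),
          Real.exp_le_exp, Real.log_mul (by positivity) (by positivity)]
        linarith
      have h10 : 1 ≤ (1 + ε) * (ρ₀ r * ‖r‖) := by
        have := one_le_mul_of_one_le_of_one_le hone h3
        nlinarith
      linarith
  filter_upwards [hlower, hupper] with r h1 h2 using ⟨h1, h2⟩

end NonlocalHeat

theorem mainTheorem4 {d : ℕ} (hd : 0 < d) (a : NonlocalHeat.E d → ℝ) (C₁ b p : ℝ)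
    (ha : NonlocalHeat.IsKernel a) (hb : 0 < b) (hp : 1 ≤ p)
    (hlt : NonlocalHeat.LightTail a C₁ b p)
    (hA1 : p = 1 → NonlocalHeat.CondA1 a b) :
    -- the series defining `v` converges and `ξ_r` is well defined
    (∀ (x : NonlocalHeat.E d) (t : ℝ), Summable (NonlocalHeat.heatTerm a x t)) ∧
    (∀ r : NonlocalHeat.E d, r ≠ 0 → ∃! ξ : ℝ, NonlocalHeat.IsXi a r ξ) ∧
    -- the upper bound for `x = r t (1 + o(1))`
    (∀ r : NonlocalHeat.E d, r ≠ 0 → ∀ x : ℝ → NonlocalHeat.E d,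
      Asymptotics.IsLittleO Filter.atTop (fun t : ℝ => x t - t • r) (fun t : ℝ => t) →
      ∃ ε : ℝ → ℝ, Filter.Tendsto ε Filter.atTop (nhds 0) ∧
        ∀ᶠ t : ℝ in Filter.atTop,
          NonlocalHeat.heatKernel a (x t) t
            ≤ Real.exp (-(NonlocalHeat.Phi a r) * t * (1 + ε t))) ∧
    -- properties of `Φ`
    NonlocalHeat.Phi a 0 = 0 ∧
    (∀ r : NonlocalHeat.E d, r ≠ 0 → 0 < NonlocalHeat.Phi a r) ∧
    ConvexOn ℝ Set.univ (NonlocalHeat.Phi a) ∧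
    Asymptotics.IsEquivalent (nhds 0) (NonlocalHeat.Phi a)
      (fun r : NonlocalHeat.E d =>
        1 / 2 * (((NonlocalHeat.covMatrix a)⁻¹.mulVec (fun i => r i)) ⬝ᵥ (fun i => r i))) ∧
    Filter.Tendsto (NonlocalHeat.Phi a) (Bornology.cobounded (NonlocalHeat.E d)) Filter.atTop ∧
    (p = 1 →
      Asymptotics.IsEquivalent (Bornology.cobounded (NonlocalHeat.E d)) (NonlocalHeat.Phi a)
        (fun r => b * ‖r‖)) ∧
    (1 < p → NonlocalHeat.CondAp a b p →
      Asymptotics.IsEquivalent (Bornology.cobounded (NonlocalHeat.E d)) (NonlocalHeat.Phi a)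
        (fun r => p / (p - 1) * (b * (p - 1)) ^ (1 / p) * ‖r‖ *
          (Real.log ‖r‖) ^ ((p - 1) / p))) ∧
    (∀ μ : ℝ, 0 < μ → NonlocalHeat.SuppInBall a μ →
      ∀ᶠ r in Bornology.cobounded (NonlocalHeat.E d),
        1 / μ * ‖r‖ * Real.log ‖r‖ ≤ NonlocalHeat.Phi a r) := by
  have hbd := fun {γ : NonlocalHeat.E d} (hγ : γ ∈ NonlocalHeat.expDomain a) =>
    NonlocalHeat.exists_exp_inner_mul_le ha hb hp hlt hA1 hγ
  refine ⟨fun x t => ?_, fun r _ => NonlocalHeat.existsUnique_isXi ha r, fun r hr x hx =>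
    NonlocalHeat.exists_heatKernel_le ha hb hp hlt hA1 (NonlocalHeat.Phi_pos ha hb hp hlt hr) hx,
    NonlocalHeat.Phi_zero ha, fun r hr => NonlocalHeat.Phi_pos ha hb hp hlt hr,
    NonlocalHeat.convexOn_Phi ha, NonlocalHeat.isEquivalent_Phi_zero ha hb hp hlt,
    NonlocalHeat.tendsto_Phi_cobounded ha hb hp hlt,
    fun h => NonlocalHeat.isEquivalent_Phi_of_condA1 ha hb hp hlt (hA1 h),
    fun h hAp => NonlocalHeat.isEquivalent_Phi_of_condAp ha hb h hAp,
    fun μ hμ hs => hs.eventually_le_Phi ha hμ⟩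
  obtain ⟨B, hB⟩ := hbd (NonlocalHeat.zero_mem_expDomain ha)
  exact NonlocalHeat.summable_heatTerm ha (NonlocalHeat.zero_mem_expDomain ha) hB x t
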